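/- Let $n\ge 1$ and let $M$ be a connected smooth $n$-manifold without boundary, properly immersed in $\mathbb R^{n+1}$ by a smooth immersion $x:M\to\mathbb R^{n+1}$, complete in the induced metric, with a smooth unit normal field (Gauss map) $N:M\to S^n\subset\mathbb R^{n+1}$. Let $A(v,w)=\langle \bar\nabla_v W,N\rangle$ be the second fundamental form, where $\bar\nabla$ is the flat connection of $\mathbb R^{n+1}$ and $W$ is a tangent vector field extending $w$, and let $H$ be the trace of $A$ with respect to the induced metric. Suppose that $M$ is a $\lambda$-hypersurface of the Gaussian space, that is, $$H+\tfrac12\langle x,N\rangle=\lambda\quad\text{on } M$$ for a constant $\lambda\in\mathbb R$, and suppose that the image of the Gauss map lies in the closed hemisphere $x_{n+1}\ge 0$, that is, the last coordinate of $N$ is nonnegative on $M$. Then at least one of the following holds: (i) $M$ is a hyperplane: $x$ is an embedding of $M$ onto an affine hyperplane of $\mathbb R^{n+1}$; (ii) $M$ splits isometrically as $M=\tilde M^{n-1}\times\mathbb R$, where $\tilde M$ is a connected immersed $\lambda$-hypersurface of $\mathbb R^n\times\{0\}$, with the same constant $\lambda$. That is, there are a connected smooth $(n-1)$-manifold $\tilde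 M$, a smooth immersion $\tilde x:\tilde M\to\mathbb R^n$ with a smooth unit normal field $\tilde N$ such that $\tilde H+\frac12\langle\tilde x,\tilde N\rangle=\lambda$ on $\tilde M$ (where $\tilde H$ is defined as above, and $\tilde H=0$ if $n=1$), and a diffeomorphism $\Phi:\tilde M\times\mathbb R\to M$ which is an isometry from the product metric to the induced metric of $M$ and satisfies $x(\Phi(q,t))=(\tilde x(q),t)$ for all $q\in\tilde M$ and $t\in\mathbb R$. -/

import Mathlib

open scoped Manifold ContDiff Topology

namespace GaussianHypersurface

universe u

noncomputable section

/-- `R^k` with its Euclidean inner product. -/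
abbrev Euc (k : ℕ) : Type := EuclideanSpace ℝ (Fin k)

section LocalGeometry

variable {n : ℕ} {M : Type*} [TopologicalSpace M] [ChartedSpace (Euc n) M]

/-- The differential `dX_p : T_pM → R^{n+1}` of a map `X : M → R^{n+1}`; as always in Mathlib,
`T_pM` is identified with the model space through the preferred chart at `p`. -/
def differential (X : M → Euc (n + 1)) (p : M) : TangentSpace (𝓡 n) p →L[ℝ] Euc (n + 1) :=
  mfderiv (𝓡 n) (𝓡 (n + 1)) X p

/-- The metric induced by `X` (first fundamental form), `g_p(v, w) = ⟨dX_p v, dX_p w⟩`. -/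
def inducedMetric (X : M → Euc (n + 1)) (p : M) (v w : TangentSpace (𝓡 n) p) : ℝ :=
  inner ℝ (differential X p v) (differential X p w)

/-- The scalar second fundamental form `A_p(v, w) = ⟨D_v W, N⟩`, where `D` is the flat connection
of `R^{n+1}` and `W` extends `w`. With `W` the coordinate field of the preferred chart at `p`,
`D_v W` is the second derivative at `p` of `X` read in that chart. -/
def secondFundamentalForm (X N : M → Euc (n + 1)) (p : M) (v w : TangentSpace (𝓡 n) p) : ℝ :=
  inner ℝ
    ((fderiv ℝ (fderiv ℝ (X ∘ (extChartAt (𝓡 n) p).symm)) (extChartAt (𝓡 n) p p) v) w : Euc (n + 1))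
    (N p)

/-- The `i`-th vector of the coordinate basis of `T_pM`. -/
def coordVec (p : M) (i : Fin n) : TangentSpace (𝓡 n) p :=
  (EuclideanSpace.single i (1 : ℝ) : Euc n)

/-- The matrix `g_ij` of the induced metric in the coordinate basis. -/
def metricMatrix (X : M → Euc (n + 1)) (p : M) : Matrix (Fin n) (Fin n) ℝ :=
  Matrix.of fun i j => inducedMetric X p (coordVec p i) (coordVec p j)

/-- The matrix `A_ij` of the second fundamental form in the coordinate basis. -/
def secondFundamentalMatrix (X N : M → Euc (n + 1)) (p : M) : Matrix (Fin n) (Fin n) ℝ :=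
  Matrix.of fun i j => secondFundamentalForm X N p (coordVec p i) (coordVec p j)

/-- The mean curvature `H = g^{ij} A_ij`: the trace of the second fundamental form with respect to
the induced metric (no division by `n`; the outward normal of a round sphere gives `H < 0`). -/
def meanCurvature (X N : M → Euc (n + 1)) (p : M) : ℝ :=
  ((metricMatrix X p)⁻¹ * secondFundamentalMatrix X N p).trace

/-- The weighted mean curvature `H_f = H + ⟨x, N⟩ / 2` in the Gaussian space,
where `f(x) = |x|^2 / 4`. -/
def weightedMeanCurvature (X N : M → Euc (n + 1)) (p : M) : ℝ :=
  meanCurvature X N p + (1 / 2) * inner ℝ (X p) (N p)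

/-- `X : M → R^{n+1}` is a smooth immersion of the `n`-manifold `M` with smooth unit normal field
(Gauss map) `N`, and its weighted mean curvature is the constant `lam`. -/
structure IsLambdaHypersurface (X N : M → Euc (n + 1)) (lam : ℝ) : Prop where
  smooth : ContMDiff (𝓡 n) (𝓡 (n + 1)) ∞ X
  immersion : ∀ p, Function.Injective (differential X p)
  normal_smooth : ContMDiff (𝓡 n) (𝓡 (n + 1)) ∞ N
  normal_unit : ∀ p, ‖N p‖ = 1
  normal_orthogonal : ∀ p (v : TangentSpace (𝓡 n) p), inner ℝ (differential X p v) (N p) = 0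
  curvature : ∀ p, weightedMeanCurvature X N p = lam

/-- The Riemannian distance of the metric induced by `X`: the infimum of the lengths of the `C^1`
curves of `M` from `p` to `q`. The length of a curve is that of its image under `X`. -/
def intrinsicEDist (X : M → Euc (n + 1)) (p q : M) : ENNReal :=
  ⨅ (γ : ℝ → M) (_ : ContMDiffOn 𝓘(ℝ, ℝ) (𝓡 n) 1 γ (Set.Icc 0 1)) (_ : γ 0 = p) (_ : γ 1 = q),
    ∫⁻ t in Set.Icc (0 : ℝ) 1, ‖derivWithin (X ∘ γ) (Set.Icc 0 1) t‖ₑ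

/-- `M` is complete for the induced metric: Cauchy sequences for the Riemannian distance
converge. -/
def IsCompleteImmersion (X : M → Euc (n + 1)) : Prop :=
  ∀ u : ℕ → M,
    (∀ ε : ENNReal, 0 < ε → ∃ K : ℕ, ∀ i ≥ K, ∀ j ≥ K, intrinsicEDist X (u i) (u j) < ε) →
      ∃ p, Filter.Tendsto u Filter.atTop (𝓝 p)

/-- The immersed hypersurface `X : M → R^{n+1}` is a hyperplane: `X` embeds `M` onto
`{x | ⟨v, x⟩ = c}` for a unit vector `v` and a real number `c`. -/
def IsHyperplane (X : M → Euc (n + 1)) : Prop :=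
  Topology.IsEmbedding X ∧
    ∃ (v : Euc (n + 1)) (c : ℝ), ‖v‖ = 1 ∧ Set.range X = {x | inner ℝ v x = c}

end LocalGeometry

/-- The hypersurface `X : M^{n+1} → R^{n+2}` splits isometrically as `M = M' × R`, where `M'` is a
connected hypersurface of `R^{n+1} × {0}`, immersed by `X'`, of constant weighted mean curvature
`lam`. The diffeomorphism `Φ : M' × R → M` carries the product metric to the induced metric, and
realizes the splitting in the ambient space: `X(Φ(q, t)) = (X'(q), t)`. -/
def SplitsAsCylinder {n : ℕ} {M : Type u} [TopologicalSpace M] [ChartedSpace (Euc (n + 1)) M]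
    (X : M → Euc (n + 2)) (lam : ℝ) : Prop :=
  ∃ (M' : Type u) (_ : TopologicalSpace M') (_ : ChartedSpace (Euc n) M')
    (_ : IsManifold (𝓡 n) ∞ M') (_ : T2Space M') (_ : SecondCountableTopology M')
    (_ : ConnectedSpace M')
    (X' N' : M' → Euc (n + 1))
    (Φ : Diffeomorph ((𝓡 n).prod 𝓘(ℝ, ℝ)) (𝓡 (n + 1)) (M' × ℝ) M ∞),
    IsLambdaHypersurface X' N' lam ∧
    (∀ (q : M') (t : ℝ) (v w : TangentSpace (𝓡 n) q) (a b : ℝ),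
      inducedMetric X (Φ (q, t))
          (mfderiv ((𝓡 n).prod 𝓘(ℝ, ℝ)) (𝓡 (n + 1)) Φ (q, t) (v, a))
          (mfderiv ((𝓡 n).prod 𝓘(ℝ, ℝ)) (𝓡 (n + 1)) Φ (q, t) (w, b)) =
        inducedMetric X' q v w + a * b) ∧
    (∀ (q : M') (t : ℝ),
      (∀ i : Fin (n + 1), X (Φ (q, t)) i.castSucc = X' q i) ∧
      X (Φ (q, t)) (Fin.last (n + 1)) = t)

end

end GaussianHypersurface

/-! Write `e` for the last basis vector, `V = ⟨N, e⟩ ≥ 0`, `m` for the dimension of `M`, and `𝓛 = Δ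
- ½⟨x, ∇ ·⟩` for the drift Laplacian of the Gaussian weight. Differentiating `H + ½⟨x, N⟩ = lam` and
using Codazzi gives `𝓛 N = -|A|² N` (`driftLaplacian_normal`), so `V` is superharmonic for `𝓛`. By
the strong maximum principle (`eq_of_min`), `V` either vanishes identically or is positive
everywhere.

If `V > 0`: `𝓛|x|² = 2m + 2 lam ⟨x, N⟩ - |x|²` is negative outside a ball, whose preimage is compact
because `X` is proper. Hence `V + ε|x|²` has no local minimum out there, and `V` attains its infimum
(`exists_isMin`). The strong maximum principle makes `V` a positive constant; then `|A|² V = 0`, so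
`N` is constant (`normal_eq_of_pos`) and `M` is a hyperplane (`isHyperplane_of_normal_eq`).

If `V = 0`: `e` is tangent everywhere. Properness turns `X`, restricted to the preimage of a line
parallel to `e`, into a covering of that line, so all these lines lift to `M` (`exists_lift`) and
form a smooth flow `φ`. The factor `M'` is the slice of `M` where the last coordinate vanishes, and
`(q, t) ↦ φ(q, t)` is the splitting.

The analysis avoids intrinsic differential operators. Near each point `M` is a graph over its
tangent space, and at the centre of such a chart the metric agrees with the identity to first order,
so ordinary second derivatives suffice. The operator `𝓛` enters only through the second derivative
test at a local minimum of `V + θ(|x - Q|²)` (`exists_nonneg_of_isLocalMin`): `θ` is exponential for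
Hopf's barrier, linear for the exhaustion argument, and zero when `V` is constant. -/

namespace GaussianHypersurface

/-! ### Inverse function theorem on the manifold -/

section LocalDiffeo

variable {m : ℕ} {M : Type*} [TopologicalSpace M] [ChartedSpace (Euc m) M]

/-- A function on `M` read in the preferred chart is smooth on the target of the chart. -/
theorem contDiffOn_comp_extChartAt_symm [IsManifold (𝓡 m) ∞ M] {F : Type*}
    [NormedAddCommGroup F] [NormedSpace ℝ F] {G : M → F} (hG : ContMDiff (𝓡 m) 𝓘(ℝ, F) ∞ G)
    (p : M) : ContDiffOn ℝ ∞ (G ∘ (extChartAt (𝓡 m) p).symm) (extChartAt (𝓡 m) p).target := by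
  rw [← contMDiffOn_iff_contDiffOn]
  exact hG.comp_contMDiffOn (contMDiffOn_extChartAt_symm p)

theorem mfderiv_eq_fderiv_comp_symm [IsManifold (𝓡 m) ∞ M] {F : Type*}
    [NormedAddCommGroup F] [NormedSpace ℝ F] {G : M → F} (hG : ContMDiff (𝓡 m) 𝓘(ℝ, F) ∞ G)
    (p : M) : mfderiv (𝓡 m) 𝓘(ℝ, F) G p =
      fderiv ℝ (G ∘ (extChartAt (𝓡 m) p).symm) (extChartAt (𝓡 m) p p) := by
  rw [(hG.mdifferentiable (by simp) p).mfderiv]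
  simp only [writtenInExtChartAt, extChartAt_model_space_eq_id, PartialEquiv.refl_coe,
    Function.id_comp, modelWithCornersSelf_coe, Set.range_id, fderivWithin_univ]
  rfl

/-- The inverse function theorem for a map from `M` to a normed space. -/
theorem exists_openPartialHomeomorph_of_mfderiv [IsManifold (𝓡 m) ∞ M] {E' : Type*}
    [NormedAddCommGroup E'] [NormedSpace ℝ E'] {G : M → E'}
    (hG : ContMDiff (𝓡 m) 𝓘(ℝ, E') ∞ G) (p : M)
    (hA : Function.Bijective (mfderiv (𝓡 m) 𝓘(ℝ, E') G p)) :
    ∃ f : OpenPartialHomeomorph M E', p ∈ f.source ∧ (∀ q ∈ f.source, f q = G q) ∧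
      ContMDiffOn 𝓘(ℝ, E') (𝓡 m) ∞ f.symm f.target := by
  set φ := chartAt (Euc m) p with hφ
  set y0 := φ p with hy0
  set g : Euc m → E' := G ∘ φ.symm with hg
  have hgs : ContDiffOn ℝ ∞ g φ.target := by
    simpa [hg] using contDiffOn_comp_extChartAt_symm hG p
  have hy0t : y0 ∈ φ.target := mem_chart_target _ p
  have hgat : ∀ y ∈ φ.target, ContDiffAt ℝ ∞ g y := fun y hy =>
    hgs.contDiffAt (φ.open_target.mem_nhds hy)
  have hder : mfderiv (𝓡 m) 𝓘(ℝ, E') G p = fderiv ℝ g y0 := by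
    simpa [hg] using mfderiv_eq_fderiv_comp_symm hG p
  have hbij : Function.Bijective (fderiv ℝ g y0) := by rw [← hder]; exact hA
  let A0 : Euc m ≃ₗ[ℝ] E' := LinearEquiv.ofBijective (fderiv ℝ g y0).toLinearMap hbij
  have : FiniteDimensional ℝ E' := A0.finiteDimensional
  have : CompleteSpace E' := FiniteDimensional.complete ℝ E'
  let A : Euc m ≃L[ℝ] E' := A0.toContinuousLinearEquiv
  have hAe : (A : Euc m →L[ℝ] E') = fderiv ℝ g y0 := by ext v; rfl
  have hgd : HasFDerivAt g (A : Euc m →L[ℝ] E') y0 := by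
    rw [hAe]; exact ((hgat y0 hy0t).differentiableAt (by simp)).hasFDerivAt
  let e := (hgat y0 hy0t).toOpenPartialHomeomorph g hgd (by simp)
  have he : (e : Euc m → E') = g := rfl
  have hcont : ContinuousOn (fderiv ℝ g) φ.target :=
    hgs.continuousOn_fderiv_of_isOpen φ.open_target (by simp)
  -- Restricting to the points where the derivative is invertible makes the inverse smooth on the
  -- whole target, and not only at the image of `p`.
  let S : Set (Euc m) := φ.target ∩ fderiv ℝ g ⁻¹' Set.range ((↑) : (Euc m ≃L[ℝ] E') → _)
  have hS : IsOpen S := hcont.isOpen_inter_preimage φ.open_target ContinuousLinearEquiv.isOpen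
  let e' := e.restrOpen S hS
  refine ⟨φ.trans e', ?_, ?_, ?_⟩
  · simp only [OpenPartialHomeomorph.trans_source, Set.mem_inter_iff, Set.mem_preimage]
    refine ⟨mem_chart_source _ p, ?_⟩
    rw [OpenPartialHomeomorph.restrOpen_source]
    refine ⟨(hgat y0 hy0t).mem_toOpenPartialHomeomorph_source hgd (by simp), hy0t, A, hAe⟩
  · intro q hq
    simp only [OpenPartialHomeomorph.trans_source, Set.mem_inter_iff] at hq
    change g (φ q) = G q
    simp only [hg, Function.comp_apply, φ.left_inv hq.1]
  · intro a ha
    simp only [OpenPartialHomeomorph.trans_target, Set.mem_inter_iff, Set.mem_preimage] at ha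
    have hsrc : e'.symm a ∈ e.source ∩ S := by
      rw [← OpenPartialHomeomorph.restrOpen_source]; exact e'.map_target ha.1
    obtain ⟨B, hB⟩ := hsrc.2.2
    have h1 : ContDiffAt ℝ ∞ e'.symm a := by
      refine e'.contDiffAt_symm (f₀' := B) ha.1 ?_ (hgat _ ha.2)
      rw [hB]
      exact ((hgat _ ha.2).differentiableAt (by simp)).hasFDerivAt
    have h2 : ContMDiffAt (𝓡 m) (𝓡 m) ∞ φ.symm (e'.symm a) :=
      contMDiffOn_chart_symm.contMDiffAt (φ.open_target.mem_nhds ha.2)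
    exact (h2.comp a h1.contMDiffAt).contMDiffWithinAt

end LocalDiffeo

/-! ### Traces with respect to a metric -/

section Trace

variable {m : ℕ}

theorem eq_sum_smul_single (b : Euc m) :
    b = ∑ k, b k • (EuclideanSpace.single k (1 : ℝ) : Euc m) := by
  have := ((EuclideanSpace.basisFun (Fin m) ℝ).sum_repr b).symm
  simpa using this

theorem congr_matrix_apply (β : Euc m →ₗ[ℝ] Euc m →ₗ[ℝ] ℝ) (b : Fin m → Euc m) :
    (Matrix.of fun i j => b j i).transpose *
        (Matrix.of fun i j => β (EuclideanSpace.single i 1) (EuclideanSpace.single j 1)) *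
        (Matrix.of fun i j => b j i) = Matrix.of fun i j => β (b i) (b j) := by
  ext i j
  simp only [Matrix.mul_apply, Matrix.transpose_apply, Matrix.of_apply]
  conv_rhs => rw [eq_sum_smul_single (b i), eq_sum_smul_single (b j)]
  simp only [map_sum, map_smul, LinearMap.sum_apply, LinearMap.smul_apply, smul_eq_mul,
    Finset.sum_mul, Finset.mul_sum]
  refine Finset.sum_congr rfl fun k _ => ?_
  refine Finset.sum_congr rfl fun l _ => ?_
  ring

/-- If `P` has the `γ`-orthonormal vectors `b i` as columns, then `Pᵀ G P = 1`, so `G⁻¹ = P Pᵀ`, and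
cyclicity of the trace gives `tr (G⁻¹ A) = tr (Pᵀ A P)`. -/
theorem trace_inv_mul_eq_sum (γ β : Euc m →ₗ[ℝ] Euc m →ₗ[ℝ] ℝ) (b : Fin m → Euc m)
    (hb : ∀ i j, γ (b i) (b j) = if i = j then 1 else 0) :
    ((Matrix.of fun i j => γ (EuclideanSpace.single i 1) (EuclideanSpace.single j 1))⁻¹ *
      (Matrix.of fun i j => β (EuclideanSpace.single i 1) (EuclideanSpace.single j 1))).trace =
      ∑ i, β (b i) (b i) := by
  set P : Matrix (Fin m) (Fin m) ℝ := Matrix.of fun i j => b j i with hP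
  set G : Matrix (Fin m) (Fin m) ℝ :=
    Matrix.of fun i j => γ (EuclideanSpace.single i 1) (EuclideanSpace.single j 1) with hG
  set A : Matrix (Fin m) (Fin m) ℝ :=
    Matrix.of fun i j => β (EuclideanSpace.single i 1) (EuclideanSpace.single j 1) with hA
  have h1 : P.transpose * G * P = 1 := by
    rw [hP, hG, congr_matrix_apply]
    ext i j
    simp [hb, Matrix.one_apply]
  have h2 : G⁻¹ = P * P.transpose := by
    refine Matrix.inv_eq_left_inv ?_
    rw [Matrix.mul_assoc]
    exact mul_eq_one_comm.mp h1
  have h3 : P.transpose * A * P = Matrix.of fun i j => β (b i) (b j) := congr_matrix_apply β b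
  rw [h2, Matrix.mul_assoc, Matrix.trace_mul_comm, h3]
  simp [Matrix.trace]

/-- The trace of a form `⟨B(v, w), ν⟩` with respect to the metric `⟨Dv, Dw⟩`, computed in a basis
which is orthonormal for the metric. -/
theorem trace_inv_mul_eq_sum_inner {F : Type*} [NormedAddCommGroup F] [InnerProductSpace ℝ F]
    (D : Euc m →L[ℝ] F) (B : Euc m →L[ℝ] Euc m →L[ℝ] F) (ν : F) (b : Fin m → Euc m)
    (hb : Orthonormal ℝ fun i => D (b i)) :
    ((Matrix.of fun i j : Fin m => (inner ℝ (D (EuclideanSpace.single i 1))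
        (D (EuclideanSpace.single j 1)) : ℝ))⁻¹ *
      (Matrix.of fun i j : Fin m => (inner ℝ (B (EuclideanSpace.single i 1)
        (EuclideanSpace.single j 1)) ν : ℝ))).trace = ∑ i, inner ℝ (B (b i) (b i)) ν := by
  let γ : Euc m →ₗ[ℝ] Euc m →ₗ[ℝ] ℝ :=
    LinearMap.mk₂ ℝ (fun v w => inner ℝ (D v) (D w))
      (fun u v w => by simp [inner_add_left]) (fun c v w => by simp [inner_smul_left])
      (fun u v w => by simp [inner_add_right]) (fun c v w => by simp [inner_smul_right])
  let β : Euc m →ₗ[ℝ] Euc m →ₗ[ℝ] ℝ :=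
    LinearMap.mk₂ ℝ (fun v w => inner ℝ (B v w) ν)
      (fun u v w => by simp [inner_add_left]) (fun c v w => by simp [inner_smul_left])
      (fun u v w => by simp [inner_add_left]) (fun c v w => by simp [inner_smul_left])
  exact trace_inv_mul_eq_sum γ β b fun i j => orthonormal_iff_ite.mp hb i j

end Trace

/-! ### Mean curvature through accelerations of curves -/

section Curves

theorem two_le_infty : (2 : WithTop ℕ∞) ≤ ∞ :=
  WithTop.coe_le_coe.mpr (le_top : (2 : ℕ∞) ≤ ⊤)

/-- The derivatives of first and second order of a function along a curve. -/
theorem deriv_deriv_comp {E F : Type*} [NormedAddCommGroup E] [NormedSpace ℝ E]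
    [NormedAddCommGroup F] [NormedSpace ℝ F] {x : E → F} {y : ℝ → E} {t : ℝ}
    (hx : ContDiffAt ℝ 2 x (y t)) (hy : ContDiffAt ℝ 2 y t) :
    deriv (x ∘ y) t = fderiv ℝ x (y t) (deriv y t) ∧
    deriv (deriv (x ∘ y)) t = fderiv ℝ (fderiv ℝ x) (y t) (deriv y t) (deriv y t) +
      fderiv ℝ x (y t) (deriv (deriv y) t) := by
  have hxe : ∀ᶠ s in 𝓝 t, DifferentiableAt ℝ x (y s) := by
    have : ∀ᶠ z in 𝓝 (y t), ContDiffAt ℝ 2 x z := hx.eventually (by simp)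
    exact (hy.continuousAt.eventually this).mono fun s hs => hs.differentiableAt (by simp)
  have hye : ∀ᶠ s in 𝓝 t, DifferentiableAt ℝ y s :=
    (hy.eventually (by simp)).mono fun s hs => hs.differentiableAt (by simp)
  have h1 : deriv (x ∘ y) =ᶠ[𝓝 t] fun s => fderiv ℝ x (y s) (deriv y s) := by
    filter_upwards [hxe, hye] with s h1 h2
    exact fderiv_comp_deriv s h1 h2
  refine ⟨h1.self_of_nhds, ?_⟩
  rw [h1.deriv_eq]
  have hdx : DifferentiableAt ℝ (fderiv ℝ x) (y t) :=
    (hx.fderiv_right (m := 1) (by norm_num)).differentiableAt (by simp)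
  have hdy : DifferentiableAt ℝ (deriv y) t := by
    have : ContDiffAt ℝ 1 (fun s => fderiv ℝ y s 1) t :=
      (hy.fderiv_right (m := 1) (by norm_num)).clm_apply contDiffAt_const
    exact this.differentiableAt (by simp)
  have h2 : HasDerivAt (fun s => fderiv ℝ x (y s)) (fderiv ℝ (fderiv ℝ x) (y t) (deriv y t)) t :=
    hdx.hasFDerivAt.comp_hasDerivAt t hye.self_of_nhds.hasDerivAt
  exact (h2.clm_apply hdy.hasDerivAt).deriv

variable {m : ℕ} {M : Type*} [TopologicalSpace M] [ChartedSpace (Euc m) M]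
  [IsManifold (𝓡 m) ∞ M]

theorem differential_eq_fderiv {X : M → Euc (m + 1)} (hX : ContMDiff (𝓡 m) (𝓡 (m + 1)) ∞ X)
    (p : M) : differential X p =
      fderiv ℝ (X ∘ (extChartAt (𝓡 m) p).symm) (extChartAt (𝓡 m) p p) :=
  mfderiv_eq_fderiv_comp_symm hX p

/-- The mean curvature is the normal part of the accelerations of curves with orthonormal
velocities. -/
theorem meanCurvature_eq_sum {X N : M → Euc (m + 1)} (hX : ContMDiff (𝓡 m) (𝓡 (m + 1)) ∞ X)
    {p : M} (hN : ∀ v : TangentSpace (𝓡 m) p, inner ℝ (differential X p v) (N p) = 0)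
    {c : Fin m → ℝ → M} (hc0 : ∀ i, c i 0 = p)
    (hc : ∀ i, ContMDiffAt 𝓘(ℝ, ℝ) (𝓡 m) ∞ (c i) 0)
    (ho : Orthonormal ℝ fun i => deriv (X ∘ c i) 0) :
    meanCurvature X N p = ∑ i, inner ℝ (deriv (deriv (X ∘ c i)) 0) (N p) := by
  set φ := extChartAt (𝓡 m) p with hφ
  set x := X ∘ φ.symm with hx
  let y : Fin m → ℝ → Euc m := fun i => φ ∘ c i
  have hy0 : ∀ i, y i 0 = φ p := fun i => by simp [y, hc0]
  have hxs : ContDiffAt ℝ 2 x (φ p) :=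
    ((contDiffOn_comp_extChartAt_symm hX p).contDiffAt
      (extChartAt_target_mem_nhds p)).of_le two_le_infty
  have hys : ∀ i, ContDiffAt ℝ 2 (y i) 0 := fun i => by
    have h1 : ContMDiffAt (𝓡 m) 𝓘(ℝ, Euc m) ∞ φ (c i 0) := by
      rw [hc0]; exact contMDiffAt_extChartAt
    exact (contMDiffAt_iff_contDiffAt.mp (h1.comp 0 (hc i))).of_le two_le_infty
  have hxy : ∀ i, X ∘ c i =ᶠ[𝓝 0] x ∘ y i := fun i => by
    have h1 : ∀ᶠ t in 𝓝 (0 : ℝ), c i t ∈ φ.source := by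
      refine (hc i).continuousAt ?_
      rw [hc0]
      exact extChartAt_source_mem_nhds p
    filter_upwards [h1] with t ht
    simp [hx, y, φ.left_inv ht]
  have hd : ∀ i, deriv (X ∘ c i) 0 = fderiv ℝ x (φ p) (deriv (y i) 0) ∧
      deriv (deriv (X ∘ c i)) 0 = fderiv ℝ (fderiv ℝ x) (φ p) (deriv (y i) 0) (deriv (y i) 0) +
      fderiv ℝ x (φ p) (deriv (deriv (y i)) 0) := fun i => by
    have := deriv_deriv_comp (x := x) (y := y i) (t := 0) (by rw [hy0]; exact hxs) (hys i)
    rw [(hxy i).deriv_eq, (hxy i).deriv.deriv_eq, ← hy0 i]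
    exact this
  have hD : differential X p = fderiv ℝ x (φ p) := differential_eq_fderiv hX p
  have hb : Orthonormal ℝ fun i => fderiv ℝ x (φ p) (deriv (y i) 0) := by
    simpa only [(hd _).1] using ho
  have key := trace_inv_mul_eq_sum_inner (fderiv ℝ x (φ p)) (fderiv ℝ (fderiv ℝ x) (φ p)) (N p)
    (fun i => deriv (y i) 0) hb
  have hN' : ∀ v, inner ℝ (fderiv ℝ x (φ p) v) (N p) = 0 := fun v => by
    rw [← hD]; exact hN v
  -- The term `Dx(y'')` of the acceleration is tangent, so the normal `N p` does not see it: only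
  -- the velocities of the curves matter.
  simp only [(hd _).2, inner_add_left, hN', add_zero]
  rw [← key]
  unfold meanCurvature metricMatrix inducedMetric
  rw [hD]
  rfl

end Curves

/-! ### Derivative of a trace where the metric is the identity to first order -/

section TraceDerivative

variable {m : ℕ} {E : Type*} [NormedAddCommGroup E] [NormedSpace ℝ E]

/-- The product of an `o(|z - y|)` and a bounded function is `o(|z - y|)`; the second factor need
only be continuous. -/
theorem hasFDerivAt_mul_of_zero {f g : E → ℝ} {y : E} (hf : HasFDerivAt f (0 : E →L[ℝ] ℝ) y)
    (hf0 : f y = 0) (hg : ContinuousAt g y) :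
    HasFDerivAt (fun z => f z * g z) (0 : E →L[ℝ] ℝ) y := by
  rw [hasFDerivAt_iff_isLittleO] at hf ⊢
  simp only [hf0, zero_mul, sub_zero, zero_apply] at hf ⊢
  have := hf.norm_right.mul_isBigO (hg.isBigO_one ℝ)
  simpa using this

/-- The derivative of `tr (G⁻¹ A)` at a point where `G = 1` and `dG = 0`. -/
theorem hasFDerivAt_trace_inv_mul {G A : E → Matrix (Fin m) (Fin m) ℝ} {y : E}
    {A' : Fin m → E →L[ℝ] ℝ} (hG0 : G y = 1)
    (hG : ∀ i j, HasFDerivAt (fun z => G z i j) (0 : E →L[ℝ] ℝ) y)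
    (hAc : ContinuousAt A y) (hA : ∀ i, HasFDerivAt (fun z => A z i i) (A' i) y) :
    HasFDerivAt (fun z => ((G z)⁻¹ * A z).trace) (∑ i, A' i) y := by
  have hGc : ContinuousAt G y :=
    continuousAt_pi.mpr fun i => continuousAt_pi.mpr fun j => (hG i j).continuousAt
  have hdet : ContinuousAt (fun z => (G z).det) y :=
    (Continuous.matrix_det continuous_id).continuousAt.comp hGc
  have hdet0 : (G y).det ≠ 0 := by simp [hG0]
  have hinv : ContinuousAt (fun z => (G z)⁻¹) y := by
    simp only [Matrix.inv_def, Ring.inverse_eq_inv']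
    exact (hdet.inv₀ hdet0).smul
      ((Continuous.matrix_adjugate continuous_id).continuousAt.comp hGc)
  -- From `G S = A` follows `tr S = tr A - tr ((G - 1) S)`. The entries of `G - 1` vanish at `y`
  -- together with their derivatives, so continuity of `S` is enough and the matrix inverse is never
  -- differentiated.
  set S : E → Matrix (Fin m) (Fin m) ℝ := fun z => (G z)⁻¹ * A z with hS
  have hSc : ContinuousAt S y :=
    (Continuous.matrix_mul continuous_fst continuous_snd).continuousAt.comp (hinv.prodMk hAc)
  have hSij : ∀ i j, ContinuousAt (fun z => S z i j) y := fun i j =>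
    continuousAt_pi.mp (continuousAt_pi.mp hSc i) j
  have hterm : ∀ i j, HasFDerivAt (fun z => (G z i j - (1 : Matrix (Fin m) (Fin m) ℝ) i j) * S z j i)
      (0 : E →L[ℝ] ℝ) y := fun i j =>
    hasFDerivAt_mul_of_zero ((hG i j).sub_const _) (by simp [hG0]) (hSij j i)
  have hsum : HasFDerivAt (fun z => ∑ i, A z i i - ∑ i, ∑ j,
      (G z i j - (1 : Matrix (Fin m) (Fin m) ℝ) i j) * S z j i) (∑ i, A' i) y := by
    have h := (HasFDerivAt.fun_sum fun i (_ : i ∈ Finset.univ) => hA i).sub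
      (HasFDerivAt.fun_sum fun i (_ : i ∈ Finset.univ) =>
        HasFDerivAt.fun_sum fun j (_ : j ∈ Finset.univ) => hterm i j)
    simp only [Finset.sum_const_zero, sub_zero] at h
    exact h
  refine hsum.congr_of_eventuallyEq ?_
  filter_upwards [hdet.eventually_ne hdet0] with z hz
  have h1 : G z * S z = A z := by
    rw [hS, ← Matrix.mul_assoc, Matrix.mul_nonsing_inv _ (isUnit_iff_ne_zero.mpr hz),
      Matrix.one_mul]
  have h2 : ((G z - 1) * S z).trace = (A z).trace - (S z).trace := by
    rw [sub_mul, h1, one_mul, Matrix.trace_sub]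
  have h3 : ((G z - 1) * S z).trace =
      ∑ i, ∑ j, (G z i j - (1 : Matrix (Fin m) (Fin m) ℝ) i j) * S z j i := by
    simp [Matrix.trace, Matrix.mul_apply]
  have h4 : (A z).trace = ∑ i, A z i i := rfl
  rw [← h3, h2, h4]
  ring

end TraceDerivative

/-! ### The drift Laplacian of the normal, in a graph over the tangent space -/

section LocalIdentity

variable {m : ℕ} {F : Type*} [NormedAddCommGroup F] [InnerProductSpace ℝ F] [CompleteSpace F]

/-- The metric matrix and the matrix of the second fundamental form of a parametrized
hypersurface `x` with normal `ν`. -/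
noncomputable def paramMeanCurvature (x ν : Euc m → F) (y : Euc m) : ℝ :=
  ((Matrix.of fun i j : Fin m => (inner ℝ (fderiv ℝ x y (EuclideanSpace.single i 1))
        (fderiv ℝ x y (EuclideanSpace.single j 1)) : ℝ))⁻¹ *
      (Matrix.of fun i j : Fin m => (inner ℝ (fderiv ℝ (fderiv ℝ x) y (EuclideanSpace.single i 1)
        (EuclideanSpace.single j 1)) (ν y) : ℝ))).trace

variable {x ν : Euc m → F} {U : Set (Euc m)} {y₀ : Euc m} {J : Euc m →ₗᵢ[ℝ] F} {lam : ℝ}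

/-- Hypotheses on a parametrization `x` of a hypersurface with normal `ν` over an open set of its
tangent space at `x y₀`, on which `H + ⟨x, ν⟩ / 2` is constant. -/
structure IsGraphOverTangent (x ν : Euc m → F) (U : Set (Euc m)) (y₀ : Euc m)
    (J : Euc m →ₗᵢ[ℝ] F) (lam : ℝ) : Prop where
  isOpen : IsOpen U
  mem : y₀ ∈ U
  smooth : ContDiffOn ℝ ∞ x U
  normal_smooth : ContDiffOn ℝ ∞ ν U
  proj : ∀ y ∈ U, J.toContinuousLinearMap.adjoint (x y) = y
  unit : ∀ y ∈ U, ‖ν y‖ = 1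
  orthogonal : ∀ y ∈ U, ∀ u, inner ℝ (fderiv ℝ x y u) (ν y) = 0
  fderiv_eq : fderiv ℝ x y₀ = J.toContinuousLinearMap
  mem_range : ∀ w, inner ℝ w (ν y₀) = 0 → ∃ u, J u = w
  curvature : ∀ y ∈ U, paramMeanCurvature x ν y + (1 / 2) * inner ℝ (x y) (ν y) = lam

namespace IsGraphOverTangent

variable (h : IsGraphOverTangent x ν U y₀ J lam)
include h

theorem contDiffAt {y : Euc m} (hy : y ∈ U) : ContDiffAt ℝ ∞ x y :=
  h.smooth.contDiffAt (h.isOpen.mem_nhds hy)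

theorem normal_contDiffAt {y : Euc m} (hy : y ∈ U) : ContDiffAt ℝ ∞ ν y :=
  h.normal_smooth.contDiffAt (h.isOpen.mem_nhds hy)

theorem fderiv_contDiffAt {y : Euc m} (hy : y ∈ U) : ContDiffAt ℝ ∞ (fderiv ℝ x) y :=
  (h.contDiffAt hy).fderiv_right (m := ∞) (by simp)

theorem fderiv2_contDiffAt {y : Euc m} (hy : y ∈ U) : ContDiffAt ℝ ∞ (fderiv ℝ (fderiv ℝ x)) y :=
  (h.fderiv_contDiffAt hy).fderiv_right (m := ∞) (by simp)

theorem hasFDerivAt {y : Euc m} (hy : y ∈ U) : HasFDerivAt x (fderiv ℝ x y) y :=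
  ((h.contDiffAt hy).differentiableAt (by simp)).hasFDerivAt

theorem normal_hasFDerivAt {y : Euc m} (hy : y ∈ U) : HasFDerivAt ν (fderiv ℝ ν y) y :=
  ((h.normal_contDiffAt hy).differentiableAt (by simp)).hasFDerivAt

theorem fderiv_fderiv_apply {y : Euc m} (hy : y ∈ U) (u v : Euc m) :
    fderiv ℝ (fun z => fderiv ℝ x z v) y u = fderiv ℝ (fderiv ℝ x) y u v := by
  rw [fderiv_clm_apply ((h.fderiv_contDiffAt hy).differentiableAt (by simp))
    (differentiableAt_const v)]
  simp

theorem symm {y : Euc m} (hy : y ∈ U) (u v : Euc m) :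
    fderiv ℝ (fderiv ℝ x) y u v = fderiv ℝ (fderiv ℝ x) y v u :=
  (h.contDiffAt hy).isSymmSndFDerivAt (by simpa using two_le_infty) u v

theorem fderiv_apply_contDiffAt {y : Euc m} (hy : y ∈ U) (v : Euc m) :
    ContDiffAt ℝ ∞ (fun z => fderiv ℝ x z v) y :=
  (h.fderiv_contDiffAt hy).clm_apply contDiffAt_const

theorem fderiv2_apply_contDiffAt {y : Euc m} (hy : y ∈ U) (u v : Euc m) :
    ContDiffAt ℝ ∞ (fun z => fderiv ℝ (fderiv ℝ x) z u v) y :=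
  ((h.fderiv2_contDiffAt hy).clm_apply contDiffAt_const).clm_apply contDiffAt_const

theorem fderiv_eq_of_eqOn {G : Type*} [NormedAddCommGroup G] [NormedSpace ℝ G] {f g : Euc m → G}
    (hf : ∀ z ∈ U, f z = g z) {y : Euc m} (hy : y ∈ U) : fderiv ℝ f y = fderiv ℝ g y :=
  Filter.EventuallyEq.fderiv_eq (Filter.mem_of_superset (h.isOpen.mem_nhds hy) hf)

theorem proj_fderiv {y : Euc m} (hy : y ∈ U) (u : Euc m) :
    J.toContinuousLinearMap.adjoint (fderiv ℝ x y u) = u := by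
  have h1 := h.fderiv_eq_of_eqOn h.proj hy
  have h2 := (J.toContinuousLinearMap.adjoint.hasFDerivAt.comp y (h.hasFDerivAt hy)).fderiv
  have h3 : fderiv ℝ (fun z : Euc m => z) y u = u := by simp
  rw [← h1] at h3
  conv_rhs => rw [← h3]
  exact (congrArg (fun L : Euc m →L[ℝ] Euc m => L u) h2).symm

/-- Differentiate `J* x(y) = y` twice. Second derivatives of `x` are thus orthogonal to the range of
`J`, which at `y₀` is the tangent space; this is why the first derivatives of the metric vanish
there. -/
theorem proj_fderiv2 {y : Euc m} (hy : y ∈ U) (u v : Euc m) :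
    J.toContinuousLinearMap.adjoint (fderiv ℝ (fderiv ℝ x) y u v) = 0 := by
  have h1 := h.fderiv_eq_of_eqOn (fun z hz => h.proj_fderiv hz v) hy
  have h2 := (J.toContinuousLinearMap.adjoint.hasFDerivAt.comp y
    ((h.fderiv_apply_contDiffAt hy v).differentiableAt (by simp)).hasFDerivAt).fderiv
  have h3 : fderiv ℝ (fun _ : Euc m => v) y u = 0 := by simp
  rw [← h1] at h3
  rw [← h.fderiv_fderiv_apply hy, ← h3]
  exact (congrArg (fun L : Euc m →L[ℝ] Euc m => L u) h2).symm

theorem inner_fderiv2 {y : Euc m} (hy : y ∈ U) (u v w : Euc m) :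
    inner ℝ (fderiv ℝ (fderiv ℝ x) y u v) (J w) = 0 := by
  have := ContinuousLinearMap.adjoint_inner_left J.toContinuousLinearMap w
    (fderiv ℝ (fderiv ℝ x) y u v)
  rw [h.proj_fderiv2 hy] at this
  simpa using this.symm

theorem inner_normal_range (u : Euc m) : inner ℝ (J u) (ν y₀) = 0 := by
  have := h.orthogonal y₀ h.mem u
  rwa [h.fderiv_eq] at this

/-- A vector orthogonal to the tangent space is normal. -/
theorem eq_smul_normal {w : F} (hw : ∀ u, inner ℝ w (J u) = 0) :
    w = (inner ℝ w (ν y₀) : ℝ) • ν y₀ := by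
  set z := w - (inner ℝ w (ν y₀) : ℝ) • ν y₀ with hz
  have hzn : inner ℝ z (ν y₀) = 0 := by
    simp [hz, inner_sub_left, inner_smul_left, h.unit y₀ h.mem]
  obtain ⟨u, hu⟩ := h.mem_range z hzn
  have hzu : inner ℝ z (J u) = 0 := by
    rw [hz, inner_sub_left, hw, inner_smul_left, real_inner_comm (J u), h.inner_normal_range]
    simp
  rw [hu, inner_self_eq_zero] at hzu
  exact sub_eq_zero.mp hzu

theorem fderiv2_eq_smul (u v : Euc m) : fderiv ℝ (fderiv ℝ x) y₀ u v =
    (inner ℝ (fderiv ℝ (fderiv ℝ x) y₀ u v) (ν y₀) : ℝ) • ν y₀ :=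
  h.eq_smul_normal fun w => h.inner_fderiv2 h.mem u v w

theorem inner_fderiv_normal {y : Euc m} (hy : y ∈ U) (u : Euc m) :
    inner ℝ (fderiv ℝ ν y u) (ν y) = 0 := by
  have h1 : fderiv ℝ (fun z => (inner ℝ (ν z) (ν z) : ℝ)) y u = 0 := by
    rw [h.fderiv_eq_of_eqOn (g := fun _ => (1 : ℝ)) (fun z hz => by simp [h.unit z hz]) hy]
    simp
  rw [fderiv_inner_apply ℝ (h.normal_hasFDerivAt hy).differentiableAt
    (h.normal_hasFDerivAt hy).differentiableAt, real_inner_comm] at h1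
  linarith

/-- At `y₀` the second derivatives of `x` are normal while the derivatives of `ν` are tangent. This
removes the cross terms when the second fundamental form is differentiated. -/
theorem inner_fderiv_normal_fderiv2 (u v w : Euc m) :
    inner ℝ (fderiv ℝ (fderiv ℝ x) y₀ u v) (fderiv ℝ ν y₀ w) = 0 := by
  rw [h.fderiv2_eq_smul, inner_smul_left, real_inner_comm (fderiv ℝ ν y₀ w) (ν y₀),
    h.inner_fderiv_normal h.mem]
  simp

/-- Differentiate the relation `⟨Dx u, ν⟩ = 0` in the direction `v`. -/
theorem weingarten {y : Euc m} (hy : y ∈ U) (u v : Euc m) :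
    inner ℝ (fderiv ℝ (fderiv ℝ x) y v u) (ν y) +
      inner ℝ (fderiv ℝ x y u) (fderiv ℝ ν y v) = 0 := by
  have h1 : fderiv ℝ (fun z => (inner ℝ (fderiv ℝ x z u) (ν z) : ℝ)) y v = 0 := by
    rw [h.fderiv_eq_of_eqOn (g := fun _ => (0 : ℝ)) (fun z hz => h.orthogonal z hz u) hy]
    simp
  rw [fderiv_inner_apply ℝ ((h.fderiv_apply_contDiffAt hy u).differentiableAt (by simp))
    (h.normal_hasFDerivAt hy).differentiableAt, h.fderiv_fderiv_apply hy] at h1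
  linarith

theorem inner_fderiv_normal_symm (u v : Euc m) :
    inner ℝ (J u) (fderiv ℝ ν y₀ v) = inner ℝ (J v) (fderiv ℝ ν y₀ u) := by
  have h1 := h.weingarten h.mem u v
  have h2 := h.weingarten h.mem v u
  rw [h.symm h.mem] at h1
  rw [h.fderiv_eq] at h1 h2
  simp only [LinearIsometry.coe_toContinuousLinearMap] at h1 h2
  linarith

/-- The derivative of the coefficients of the second fundamental form is symmetric (Codazzi). -/
theorem codazzi (u v : Euc m) :
    fderiv ℝ (fun y => fderiv ℝ (fderiv ℝ x) y v u) y₀ v =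
      fderiv ℝ (fun y => fderiv ℝ (fderiv ℝ x) y v v) y₀ u := by
  have h1 : fderiv ℝ (fun y => fderiv ℝ (fderiv ℝ x) y v u) y₀ =
      fderiv ℝ (fun y => fderiv ℝ (fun z => fderiv ℝ x z v) y u) y₀ :=
    h.fderiv_eq_of_eqOn (fun z hz => by rw [h.symm hz, h.fderiv_fderiv_apply hz]) h.mem
  have h2 : fderiv ℝ (fun y => fderiv ℝ (fderiv ℝ x) y v v) y₀ =
      fderiv ℝ (fun y => fderiv ℝ (fun z => fderiv ℝ x z v) y v) y₀ :=
    h.fderiv_eq_of_eqOn (fun z hz => by rw [h.fderiv_fderiv_apply hz]) h.mem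
  have hg := h.fderiv_apply_contDiffAt h.mem v
  have hg' : DifferentiableAt ℝ (fderiv ℝ fun z => fderiv ℝ x z v) y₀ :=
    (hg.fderiv_right (m := ∞) (by simp)).differentiableAt (by simp)
  have h3 : ∀ a b, fderiv ℝ (fun y => fderiv ℝ (fun z => fderiv ℝ x z v) y a) y₀ b =
      fderiv ℝ (fderiv ℝ fun z => fderiv ℝ x z v) y₀ b a := fun a b => by
    rw [fderiv_clm_apply hg' (differentiableAt_const a)]
    simp
  rw [h1, h2, h3, h3]
  -- In these flat coordinates the Codazzi equation is the symmetry of the third derivative of `x`.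
  exact hg.isSymmSndFDerivAt (by simpa using two_le_infty) v u

theorem normal_fderiv_contDiffAt {y : Euc m} (hy : y ∈ U) (v : Euc m) :
    ContDiffAt ℝ ∞ (fun z => fderiv ℝ ν z v) y :=
  ((h.normal_contDiffAt hy).fderiv_right (m := ∞) (by simp)).clm_apply contDiffAt_const

/-- Differentiate `⟨Dν v, ν⟩ = 0` in the direction `v`. Summed over a basis, this yields the term
`-|A|²`. -/
theorem inner_normal_fderiv2 (v : Euc m) :
    inner ℝ (fderiv ℝ (fun z => fderiv ℝ ν z v) y₀ v) (ν y₀) = -‖fderiv ℝ ν y₀ v‖ ^ 2 := by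
  have h1 : fderiv ℝ (fun z => (inner ℝ (fderiv ℝ ν z v) (ν z) : ℝ)) y₀ v = 0 := by
    rw [h.fderiv_eq_of_eqOn (g := fun _ => (0 : ℝ)) (fun z hz => h.inner_fderiv_normal hz v) h.mem]
    simp
  rw [fderiv_inner_apply ℝ ((h.normal_fderiv_contDiffAt h.mem v).differentiableAt (by simp))
    (h.normal_hasFDerivAt h.mem).differentiableAt, real_inner_self_eq_norm_sq] at h1
  linarith

/-- Differentiate the Weingarten relation along `v`: the cross term vanishes at `y₀`, and Codazzi
moves the outer derivative from `v` to `u`. Summed over a basis, the right side becomes minus the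
derivative of `H` along `u`. -/
theorem inner_tangent_fderiv2 (u v : Euc m) :
    inner ℝ (fderiv ℝ (fun z => fderiv ℝ ν z v) y₀ v) (J u) =
      -inner ℝ (fderiv ℝ (fun y => fderiv ℝ (fderiv ℝ x) y v v) y₀ u) (ν y₀) := by
  have hA : DifferentiableAt ℝ (fun z => fderiv ℝ (fderiv ℝ x) z v u) y₀ :=
    (h.fderiv2_apply_contDiffAt h.mem v u).differentiableAt (by simp)
  have hB : DifferentiableAt ℝ (fun z => fderiv ℝ x z u) y₀ :=
    (h.fderiv_apply_contDiffAt h.mem u).differentiableAt (by simp)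
  have hC : DifferentiableAt ℝ (fun z => fderiv ℝ ν z v) y₀ :=
    (h.normal_fderiv_contDiffAt h.mem v).differentiableAt (by simp)
  have hN := (h.normal_hasFDerivAt h.mem).differentiableAt
  have h1 : fderiv ℝ (fun z => (inner ℝ (fderiv ℝ (fderiv ℝ x) z v u) (ν z) : ℝ) +
      inner ℝ (fderiv ℝ x z u) (fderiv ℝ ν z v)) y₀ v = 0 := by
    rw [h.fderiv_eq_of_eqOn (g := fun _ => (0 : ℝ)) (fun z hz => h.weingarten hz u v) h.mem]
    simp
  rw [fderiv_fun_add (hA.inner ℝ hN) (hB.inner ℝ hC), add_apply,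
    fderiv_inner_apply ℝ hA hN, fderiv_inner_apply ℝ hB hC, h.fderiv_fderiv_apply h.mem,
    h.inner_fderiv_normal_fderiv2, h.codazzi, h.fderiv_eq] at h1
  simp only [LinearIsometry.coe_toContinuousLinearMap] at h1
  rw [real_inner_comm]
  linarith

/-- The derivative of the equation `H + ⟨x, ν⟩ / 2 = lam`. -/
theorem sum_inner_fderiv3 (u : Euc m) :
    ∑ i, inner ℝ (fderiv ℝ (fun y => fderiv ℝ (fderiv ℝ x) y (EuclideanSpace.single i 1)
        (EuclideanSpace.single i 1)) y₀ u) (ν y₀) + (1 / 2) * inner ℝ (x y₀) (fderiv ℝ ν y₀ u) = 0 := by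
  set e : Fin m → Euc m := fun i => EuclideanSpace.single i 1 with he
  have hN := (h.normal_hasFDerivAt h.mem).differentiableAt
  have hx := (h.hasFDerivAt h.mem).differentiableAt
  have hA : ∀ i j, DifferentiableAt ℝ (fun z => fderiv ℝ (fderiv ℝ x) z (e i) (e j)) y₀ :=
    fun i j => (h.fderiv2_apply_contDiffAt h.mem _ _).differentiableAt (by simp)
  have hB : ∀ i, DifferentiableAt ℝ (fun z => fderiv ℝ x z (e i)) y₀ :=
    fun i => (h.fderiv_apply_contDiffAt h.mem _).differentiableAt (by simp)
  -- At `y₀` the metric matrix is `1` with zero derivative, so the derivative of `tr (G⁻¹ A)` is the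
  -- sum of the derivatives of the diagonal entries of `A`.
  have hH : HasFDerivAt (paramMeanCurvature x ν)
      (∑ i, fderiv ℝ (fun z => (inner ℝ (fderiv ℝ (fderiv ℝ x) z (e i) (e i)) (ν z) : ℝ)) y₀) y₀ := by
    refine hasFDerivAt_trace_inv_mul ?_ ?_ ?_ ?_
    · ext i j
      simp only [h.fderiv_eq, Matrix.of_apply, LinearIsometry.coe_toContinuousLinearMap,
        LinearIsometry.inner_map_map, Matrix.one_apply]
      simp [EuclideanSpace.inner_single_left]
    · intro i j
      have h1 := ((hB i).inner ℝ (hB j)).hasFDerivAt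
      refine h1.congr_fderiv (ContinuousLinearMap.ext fun v => ?_)
      rw [fderiv_inner_apply ℝ (hB i) (hB j), h.fderiv_fderiv_apply h.mem,
        h.fderiv_fderiv_apply h.mem, h.fderiv_eq]
      simp only [LinearIsometry.coe_toContinuousLinearMap, h.inner_fderiv2 h.mem]
      rw [real_inner_comm, h.inner_fderiv2 h.mem]
      simp
    · exact continuousAt_pi.mpr fun i => continuousAt_pi.mpr fun j =>
        ((hA i j).inner ℝ hN).continuousAt
    · intro i
      exact ((hA i i).inner ℝ hN).hasFDerivAt
  have h1 := (hH.add (((hx.inner ℝ hN).hasFDerivAt).const_mul (1 / 2))).fderiv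
  have h2 : fderiv ℝ (paramMeanCurvature x ν + fun y => (1 / 2) * inner ℝ (x y) (ν y)) y₀ u = 0 := by
    rw [h.fderiv_eq_of_eqOn (f := paramMeanCurvature x ν + fun y => (1 / 2) * inner ℝ (x y) (ν y))
      (g := fun _ => lam) (fun z hz => h.curvature z hz) h.mem]
    simp
  rw [h1] at h2
  simp only [add_apply, smul_apply, sum_apply, smul_eq_mul] at h2
  rw [fderiv_inner_apply ℝ hx hN, h.orthogonal y₀ h.mem] at h2
  have h3 : ∀ i, fderiv ℝ (fun z => (inner ℝ (fderiv ℝ (fderiv ℝ x) z (e i) (e i)) (ν z) : ℝ)) y₀ u =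
      inner ℝ (fderiv ℝ (fun y => fderiv ℝ (fderiv ℝ x) y (e i) (e i)) y₀ u) (ν y₀) := fun i => by
    rw [fderiv_inner_apply ℝ (hA i i) hN, h.inner_fderiv_normal_fderiv2, zero_add]
  simp only [h3, add_zero] at h2
  exact h2

/-- The drift Laplacian of the normal is `-|A|² ν`. -/
theorem driftLaplacian_normal :
    ∑ i, fderiv ℝ (fun z => fderiv ℝ ν z (EuclideanSpace.single i 1)) y₀ (EuclideanSpace.single i 1) -
      ∑ i, ((1 / 2 : ℝ) * inner ℝ (x y₀) (J (EuclideanSpace.single i 1))) •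
        fderiv ℝ ν y₀ (EuclideanSpace.single i 1) =
      -(∑ i, ‖fderiv ℝ ν y₀ (EuclideanSpace.single i 1)‖ ^ 2) • ν y₀ := by
  set e : Fin m → Euc m := fun i => EuclideanSpace.single i 1 with he
  set Z := ∑ i, fderiv ℝ (fun z => fderiv ℝ ν z (e i)) y₀ (e i) -
      ∑ i, ((1 / 2 : ℝ) * inner ℝ (x y₀) (J (e i))) • fderiv ℝ ν y₀ (e i) with hZ
  -- The identity is checked on components: the normal one gives `-|A|²`, and the tangential ones
  -- must vanish.
  have hZn : inner ℝ Z (ν y₀) = -(∑ i, ‖fderiv ℝ ν y₀ (e i)‖ ^ 2) := by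
    rw [hZ, inner_sub_left, sum_inner, sum_inner]
    simp only [inner_smul_left, h.inner_fderiv_normal h.mem, h.inner_normal_fderiv2]
    simp
  have hZt : ∀ u, inner ℝ Z (J u) = 0 := fun u => by
    obtain ⟨w, hw⟩ := h.mem_range _ (h.inner_fderiv_normal h.mem u)
    -- Self-adjointness of the Weingarten map turns the drift term, tested against `J u`, into `½⟨x,
    -- Dν u⟩`. This cancels the derivative of `H` by the differentiated curvature equation.
    have h1 : ∑ i, inner ℝ (x y₀) (J (e i)) * inner ℝ (fderiv ℝ ν y₀ (e i)) (J u) =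
        (inner ℝ (x y₀) (fderiv ℝ ν y₀ u) : ℝ) := by
      have h2 : ∀ i, inner ℝ (x y₀) (J (e i)) * inner ℝ (fderiv ℝ ν y₀ (e i)) (J u) =
          inner ℝ (J.toContinuousLinearMap.adjoint (x y₀)) (e i) * (inner ℝ (e i) w : ℝ) := fun i => by
        rw [ContinuousLinearMap.adjoint_inner_left, LinearIsometry.coe_toContinuousLinearMap,
          real_inner_comm (J u), h.inner_fderiv_normal_symm, ← hw, LinearIsometry.inner_map_map]
      simp only [h2]
      have h3 := (EuclideanSpace.basisFun (Fin m) ℝ).sum_inner_mul_inner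
        (J.toContinuousLinearMap.adjoint (x y₀)) w
      simp only [EuclideanSpace.basisFun_apply] at h3
      rw [h3, ContinuousLinearMap.adjoint_inner_left, ← hw]
      rfl
    rw [hZ, inner_sub_left, sum_inner, sum_inner]
    simp only [inner_smul_left, h.inner_tangent_fderiv2, Finset.sum_neg_distrib]
    have h4 := h.sum_inner_fderiv3 u
    simp only [RCLike.conj_to_real, mul_assoc, ← Finset.mul_sum, h1]
    linarith
  rw [h.eq_smul_normal hZt, hZn]

end IsGraphOverTangent

end LocalIdentity

/-! ### Linear algebra of hyperplanes -/

section Hyperplanes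

variable {m : ℕ}

theorem finrank_orthogonal_span_singleton_of_unit {N : Euc (m + 1)} (hN : ‖N‖ = 1) :
    Module.finrank ℝ (ℝ ∙ N)ᗮ = m := by
  have : Fact (Module.finrank ℝ (Euc (m + 1)) = m + 1) := ⟨by simp⟩
  exact Submodule.finrank_orthogonal_span_singleton (by rintro rfl; simp at hN)

theorem mem_orthogonal_span_singleton_iff {N w : Euc (m + 1)} :
    w ∈ (ℝ ∙ N)ᗮ ↔ inner ℝ w N = 0 := by
  rw [Submodule.mem_orthogonal_singleton_iff_inner_left]

/-- An injective linear map of an `m`-dimensional space into a hyperplane of `R^{m+1}` is onto. -/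
theorem exists_eq_of_inner_eq_zero {E' : Type*} [AddCommGroup E'] [Module ℝ E']
    [FiniteDimensional ℝ E'] (hE : Module.finrank ℝ E' = m) {N : Euc (m + 1)} (hN : ‖N‖ = 1)
    (L : E' →ₗ[ℝ] Euc (m + 1)) (hL : Function.Injective L) (hLN : ∀ u, inner ℝ (L u) N = 0)
    {w : Euc (m + 1)} (hw : inner ℝ w N = 0) : ∃ u, L u = w := by
  have h1 : LinearMap.range L = (ℝ ∙ N)ᗮ := by
    refine Submodule.eq_of_le_of_finrank_eq ?_ ?_
    · rintro _ ⟨u, rfl⟩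
      exact mem_orthogonal_span_singleton_iff.mpr (hLN u)
    · rw [LinearMap.finrank_range_of_inj hL, hE, finrank_orthogonal_span_singleton_of_unit hN]
  have h2 : w ∈ LinearMap.range L := h1 ▸ mem_orthogonal_span_singleton_iff.mpr hw
  exact h2

theorem exists_linearIsometry_range {k : ℕ} {F : Type*} [NormedAddCommGroup F]
    [InnerProductSpace ℝ F] [FiniteDimensional ℝ F] (W : Submodule ℝ F)
    (hW : Module.finrank ℝ W = k) : ∃ J : Euc k →ₗᵢ[ℝ] F, ∀ w, w ∈ W ↔ ∃ u, J u = w := by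
  let b := (stdOrthonormalBasis ℝ W).reindex (finCongr hW)
  refine ⟨W.subtypeₗᵢ.comp b.repr.symm.toLinearIsometry, fun w => ⟨fun hw => ?_, ?_⟩⟩
  · exact ⟨b.repr ⟨w, hw⟩, by simp⟩
  · rintro ⟨u, rfl⟩
    simp

/-- An isometric parametrization of the hyperplane orthogonal to a unit vector. -/
theorem exists_linearIsometry_orthogonal {N : Euc (m + 1)} (hN : ‖N‖ = 1) :
    ∃ J : Euc m →ₗᵢ[ℝ] Euc (m + 1), (∀ u, inner ℝ (J u) N = 0) ∧
      ∀ w, inner ℝ w N = 0 → ∃ u, J u = w := by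
  obtain ⟨J, hJ⟩ := exists_linearIsometry_range (ℝ ∙ N)ᗮ
    (finrank_orthogonal_span_singleton_of_unit hN)
  exact ⟨J, fun u => mem_orthogonal_span_singleton_iff.mp ((hJ _).mpr ⟨u, rfl⟩),
    fun w hw => (hJ w).mp (mem_orthogonal_span_singleton_iff.mpr hw)⟩

theorem adjoint_apply_apply {k : ℕ} {F : Type*} [NormedAddCommGroup F]
    [InnerProductSpace ℝ F] [CompleteSpace F] (J : Euc k →ₗᵢ[ℝ] F) (u : Euc k) :
    J.toContinuousLinearMap.adjoint (J u) = u := by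
  refine ext_inner_right ℝ fun v => ?_
  rw [ContinuousLinearMap.adjoint_inner_left]
  exact J.inner_map_map u v

end Hyperplanes

/-! ### Charts given by linear projections of the ambient space -/

section ProjectionCharts

variable {m : ℕ} {M : Type*} [TopologicalSpace M] [ChartedSpace (Euc m) M]

/-- `f` is a local chart of `M` given by a linear projection of the hypersurface `X`. -/
structure IsProjectionChart {E' : Type*} [NormedAddCommGroup E'] [NormedSpace ℝ E']
    (X : M → Euc (m + 1)) (π : Euc (m + 1) →L[ℝ] E') (f : OpenPartialHomeomorph M E') : Prop where
  proj : ∀ q ∈ f.source, f q = π (X q)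
  smooth_symm : ContMDiffOn 𝓘(ℝ, E') (𝓡 m) ∞ f.symm f.target

variable {X N : M → Euc (m + 1)} {lam : ℝ}

namespace IsLambdaHypersurface

variable (hM : IsLambdaHypersurface X N lam)
include hM

theorem hasMFDerivAt (p : M) :
    HasMFDerivAt (𝓡 m) (𝓡 (m + 1)) X p (differential X p) :=
  (hM.smooth.mdifferentiable (by simp) p).hasMFDerivAt

theorem exists_differential_eq (p : M) {w : Euc (m + 1)} (hw : inner ℝ w (N p) = 0) :
    ∃ v, differential X p v = w := by
  have : FiniteDimensional ℝ (TangentSpace (𝓡 m) p) :=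
    inferInstanceAs (FiniteDimensional ℝ (Euc m))
  have h1 : Module.finrank ℝ (TangentSpace (𝓡 m) p) = m :=
    (finrank_euclideanSpace_fin : Module.finrank ℝ (Euc m) = m)
  exact exists_eq_of_inner_eq_zero h1 (hM.normal_unit p)
    (differential X p).toLinearMap (hM.immersion p) (hM.normal_orthogonal p) hw

theorem exists_isProjectionChart [IsManifold (𝓡 m) ∞ M] {E' : Type*} [NormedAddCommGroup E'] [NormedSpace ℝ E']
    (π : Euc (m + 1) →L[ℝ] E') (p : M)
    (hπ : Function.Bijective fun v => π (differential X p v)) :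
    ∃ f : OpenPartialHomeomorph M E', p ∈ f.source ∧ IsProjectionChart X π f := by
  have hG : ContMDiff (𝓡 m) 𝓘(ℝ, E') ∞ (fun q => π (X q)) :=
    π.contMDiff.comp hM.smooth
  have hd : mfderiv (𝓡 m) 𝓘(ℝ, E') (fun q => π (X q)) p = π.comp (differential X p) :=
    (π.hasMFDerivAt.comp p (hM.hasMFDerivAt p)).mfderiv
  obtain ⟨f, hp, hf, hs⟩ := exists_openPartialHomeomorph_of_mfderiv hG p (by rw [hd]; exact hπ)
  exact ⟨f, hp, hf, hs⟩

end IsLambdaHypersurface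

namespace IsProjectionChart

variable {E' : Type*} [NormedAddCommGroup E'] [NormedSpace ℝ E']
  {π : Euc (m + 1) →L[ℝ] E'} {f : OpenPartialHomeomorph M E'}
  (hf : IsProjectionChart X π f)
include hf

theorem proj_symm {y : E'} (hy : y ∈ f.target) : π (X (f.symm y)) = y := by
  rw [← hf.proj _ (f.map_target hy), f.right_inv hy]

theorem contDiffOn_comp_symm {F : Type*} [NormedAddCommGroup F] [NormedSpace ℝ F] {G : M → F}
    (hG : ContMDiff (𝓡 m) 𝓘(ℝ, F) ∞ G) : ContDiffOn ℝ ∞ (G ∘ f.symm) f.target :=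
  contMDiffOn_iff_contDiffOn.mp (hG.comp_contMDiffOn hf.smooth_symm)

theorem contDiffAt_comp_symm {F : Type*} [NormedAddCommGroup F] [NormedSpace ℝ F] {G : M → F}
    (hG : ContMDiff (𝓡 m) 𝓘(ℝ, F) ∞ G) {y : E'} (hy : y ∈ f.target) :
    ContDiffAt ℝ ∞ (G ∘ f.symm) y :=
  (hf.contDiffOn_comp_symm hG).contDiffAt (f.open_target.mem_nhds hy)

theorem smoothAt_symm {y : E'} (hy : y ∈ f.target) :
    ContMDiffAt 𝓘(ℝ, E') (𝓡 m) ∞ f.symm y :=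
  hf.smooth_symm.contMDiffAt (f.open_target.mem_nhds hy)

/-- Derivatives along the image of a straight line. -/
theorem deriv_line {F : Type*} [NormedAddCommGroup F] [NormedSpace ℝ F] {G : M → F}
    (hG : ContMDiff (𝓡 m) 𝓘(ℝ, F) ∞ G) {y : E'} (hy : y ∈ f.target) (b : E') :
    deriv (G ∘ fun t : ℝ => f.symm (y + t • b)) 0 = fderiv ℝ (G ∘ f.symm) y b ∧
    deriv (deriv (G ∘ fun t : ℝ => f.symm (y + t • b))) 0 =
      fderiv ℝ (fderiv ℝ (G ∘ f.symm)) y b b := by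
  have hl : ∀ t : ℝ, HasDerivAt (fun t : ℝ => y + t • b) b t := fun t => by
    simpa using ((hasDerivAt_id t).smul_const b).const_add y
  have hld : deriv (fun t : ℝ => y + t • b) = fun _ => b := funext fun t => (hl t).deriv
  have hlc : ContDiffAt ℝ 2 (fun t : ℝ => y + t • b) 0 :=
    contDiffAt_const.add (contDiffAt_id.smul contDiffAt_const)
  have h := deriv_deriv_comp (x := G ∘ f.symm) (y := fun t : ℝ => y + t • b) (t := 0)
    (by simpa using (hf.contDiffAt_comp_symm hG hy).of_le two_le_infty) hlc
  rw [hld, deriv_const, map_zero, add_zero] at h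
  simp only [zero_smul, add_zero] at h
  exact h

theorem contMDiffAt_line {y : E'} (hy : y ∈ f.target) (b : E') :
    ContMDiffAt 𝓘(ℝ, ℝ) (𝓡 m) ∞ (fun t : ℝ => f.symm (y + t • b)) 0 := by
  have h1 : ContDiff ℝ ∞ (fun t : ℝ => y + t • b) :=
    contDiff_const.add (contDiff_id.smul contDiff_const)
  exact ContMDiffAt.comp (g := f.symm) (I' := 𝓘(ℝ, E')) 0
    (by simpa using hf.smoothAt_symm hy) h1.contDiffAt.contMDiffAt

variable (hM : IsLambdaHypersurface X N lam)
include hM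

theorem proj_fderiv {y : E'} (hy : y ∈ f.target) (u : E') :
    π (fderiv ℝ (X ∘ f.symm) y u) = u := by
  have h1 : (fun z => π ((X ∘ f.symm) z)) =ᶠ[𝓝 y] fun z => z :=
    Filter.mem_of_superset (f.open_target.mem_nhds hy) fun z hz => hf.proj_symm hz
  have h2 := (π.hasFDerivAt.comp y
    ((hf.contDiffAt_comp_symm hM.smooth hy).differentiableAt (by simp)).hasFDerivAt).fderiv
  have h3 : fderiv ℝ (fun z : E' => z) y u = u := by simp
  rw [← h1.fderiv_eq] at h3
  conv_rhs => rw [← h3]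
  exact (congrArg (fun L : E' →L[ℝ] E' => L u) h2).symm

theorem fderiv_eq_differential {y : E'} (hy : y ∈ f.target) (u : E') :
    ∃ v, fderiv ℝ (X ∘ f.symm) y u = differential X (f.symm y) v := by
  have h1 := ((hM.hasMFDerivAt (f.symm y)).comp y
    ((hf.smoothAt_symm hy).mdifferentiableAt (by simp)).hasMFDerivAt).mfderiv
  rw [mfderiv_eq_fderiv] at h1
  exact ⟨_, congrArg (fun L : E' →L[ℝ] Euc (m + 1) => L u) h1⟩

theorem inner_fderiv_normal {y : E'} (hy : y ∈ f.target) (u : E') :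
    inner ℝ (fderiv ℝ (X ∘ f.symm) y u) (N (f.symm y)) = 0 := by
  obtain ⟨v, hv⟩ := hf.fderiv_eq_differential hM hy u
  rw [hv]
  exact hM.normal_orthogonal _ v

/-- The derivative of the parametrization is a right inverse of `π` with values in the hyperplane
`N^⊥`; by dimension it is onto that hyperplane, so it inverts `π` there. -/
theorem fderiv_proj [FiniteDimensional ℝ E'] (hE : Module.finrank ℝ E' = m) {y : E'}
    (hy : y ∈ f.target) {w : Euc (m + 1)}
    (hw : inner ℝ w (N (f.symm y)) = 0) : fderiv ℝ (X ∘ f.symm) y (π w) = w := by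
  obtain ⟨u, hu⟩ := exists_eq_of_inner_eq_zero hE (hM.normal_unit (f.symm y))
    (fderiv ℝ (X ∘ f.symm) y).toLinearMap
    (Function.LeftInverse.injective (hf.proj_fderiv hM hy)) (hf.inner_fderiv_normal hM hy) hw
  have hu' : fderiv ℝ (X ∘ f.symm) y u = w := hu
  rw [← hu', hf.proj_fderiv hM hy]

end IsProjectionChart

namespace IsLambdaHypersurface

variable (hM : IsLambdaHypersurface X N lam)
include hM

theorem bijective_adjoint_differential (p : M)
    {J : Euc m →ₗᵢ[ℝ] Euc (m + 1)} (hJN : ∀ u, inner ℝ (J u) (N p) = 0)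
    (hJ : ∀ w, inner ℝ w (N p) = 0 → ∃ u, J u = w) :
    Function.Bijective fun v => J.toContinuousLinearMap.adjoint (differential X p v) := by
  constructor
  · intro v w hvw
    obtain ⟨a, ha⟩ := hJ _ (hM.normal_orthogonal p v)
    obtain ⟨b, hb⟩ := hJ _ (hM.normal_orthogonal p w)
    simp only [← ha, ← hb, adjoint_apply_apply] at hvw
    exact hM.immersion p (by rw [← ha, ← hb, hvw])
  · intro u
    obtain ⟨v, hv⟩ := hM.exists_differential_eq p (hJN u)
    exact ⟨v, by simp only [hv, adjoint_apply_apply]⟩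

variable [IsManifold (𝓡 m) ∞ M]

/-- Independence of the chart: both sides equal the sum of the normal accelerations of the same
curves, the images of straight lines in directions whose velocities in the ambient space are
orthonormal. -/
theorem meanCurvature_eq_paramMeanCurvature {π : Euc (m + 1) →L[ℝ] Euc m}
    {f : OpenPartialHomeomorph M (Euc m)} (hf : IsProjectionChart X π f) {y : Euc m}
    (hy : y ∈ f.target) :
    paramMeanCurvature (X ∘ f.symm) (N ∘ f.symm) y = meanCurvature X N (f.symm y) := by
  obtain ⟨J, hJN, -⟩ := exists_linearIsometry_orthogonal (hM.normal_unit (f.symm y))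
  let b : Fin m → Euc m := fun i => π (J (EuclideanSpace.single i 1))
  have hb : ∀ i, fderiv ℝ (X ∘ f.symm) y (b i) = J (EuclideanSpace.single i 1) := fun i =>
    hf.fderiv_proj hM (by simp) hy (hJN _)
  have ho : Orthonormal ℝ fun i => fderiv ℝ (X ∘ f.symm) y (b i) := by
    simp only [hb]
    exact EuclideanSpace.orthonormal_single.comp_linearIsometry J
  rw [meanCurvature_eq_sum hM.smooth (hM.normal_orthogonal _)
    (c := fun i t => f.symm (y + t • b i)) (by simp) (fun i => hf.contMDiffAt_line hy _)
    (by simpa only [(hf.deriv_line hM.smooth hy _).1] using ho)]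
  simp only [(hf.deriv_line hM.smooth hy _).2]
  exact trace_inv_mul_eq_sum_inner _ _ _ b ho

/-- Near each point the hypersurface is a graph over its tangent space. -/
theorem exists_isGraphOverTangent (p : M) : ∃ (J : Euc m →ₗᵢ[ℝ] Euc (m + 1))
    (f : OpenPartialHomeomorph M (Euc m)), p ∈ f.source ∧
      IsProjectionChart X J.toContinuousLinearMap.adjoint f ∧
      (∀ u, inner ℝ (J u) (N p) = 0) ∧
      IsGraphOverTangent (X ∘ f.symm) (N ∘ f.symm) f.target (f p) J lam := by
  obtain ⟨J, hJN, hJ⟩ := exists_linearIsometry_orthogonal (hM.normal_unit p)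
  obtain ⟨f, hp, hf⟩ := hM.exists_isProjectionChart _ p
    (hM.bijective_adjoint_differential p hJN hJ)
  refine ⟨J, f, hp, hf, hJN, f.open_target, f.map_source hp, hf.contDiffOn_comp_symm hM.smooth,
    hf.contDiffOn_comp_symm hM.normal_smooth, fun y hy => hf.proj_symm hy,
    fun y _ => hM.normal_unit _, fun y hy u => hf.inner_fderiv_normal hM hy u, ?_, ?_, ?_⟩
  · ext1 u
    have h1 : inner ℝ (J u) (N (f.symm (f p))) = 0 := by rw [f.left_inv hp]; exact hJN u
    have h2 := hf.fderiv_proj hM (by simp) (f.map_source hp) h1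
    rwa [adjoint_apply_apply] at h2
  · simpa [f.left_inv hp] using hJ
  · intro y hy
    rw [hM.meanCurvature_eq_paramMeanCurvature hf hy]
    exact hM.curvature _

end IsLambdaHypersurface

end ProjectionCharts

/-! ### Second derivative test -/

section SecondDerivativeTest

theorem deriv_nonneg_of_isLocalMin {u u' : ℝ → ℝ} {u'' : ℝ} (hmin : IsLocalMin u 0)
    (hu : ∀ᶠ t in 𝓝 0, HasDerivAt u (u' t) t) (hu' : HasDerivAt u' u'' 0) :
    u' 0 = 0 ∧ 0 ≤ u'' := by
  have h0 : u' 0 = 0 := hmin.hasDerivAt_eq_zero hu.self_of_nhds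
  refine ⟨h0, ?_⟩
  by_contra! hneg
  -- With this `ε > 0`, `v''(0) = u''/2` is still negative, so `v` has a local maximum at `0`; but
  -- minimality of `u` gives `v(t) ≥ v(0) + ε t²` nearby.
  set ε := -u'' / 4 with hε
  set v : ℝ → ℝ := fun t => u t + ε * t ^ 2 with hv
  have hv1 : ∀ᶠ t in 𝓝 (0 : ℝ), HasDerivAt v (u' t + ε * (2 * t)) t := by
    filter_upwards [hu] with t ht
    simpa using ht.fun_add ((hasDerivAt_pow 2 t).const_mul ε)
  have hv2 : deriv v =ᶠ[𝓝 0] fun t => u' t + ε * (2 * t) := hv1.mono fun t ht => ht.deriv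
  have hv3 : deriv (deriv v) 0 = u'' + ε * 2 := by
    rw [hv2.deriv_eq]
    have := hu'.fun_add (((hasDerivAt_id (0 : ℝ)).const_mul 2).const_mul ε)
    simpa using this.deriv
  have hmax : IsLocalMax v 0 := by
    refine isLocalMax_of_deriv_deriv_neg ?_ ?_ hv1.self_of_nhds.continuousAt
    · rw [hv3]; linarith
    · rw [hv2.self_of_nhds]; simp [h0]
  obtain ⟨δ, hδ, hball⟩ := Metric.eventually_nhds_iff.mp (hmin.and hmax)
  have hd : dist (δ / 2) 0 < δ := by
    rw [Real.dist_eq, sub_zero, abs_of_pos (by linarith)]; linarith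
  obtain ⟨h1, h2⟩ := hball hd
  simp only [hv] at h2
  nlinarith [sq_pos_of_pos hδ]

end SecondDerivativeTest

/-! ### The differential inequality at a local minimum -/

namespace IsGraphOverTangent

variable {m : ℕ} {x ν : Euc m → Euc (m + 1)} {U : Set (Euc m)} {y₀ : Euc m}
  {J : Euc m →ₗᵢ[ℝ] Euc (m + 1)} {lam : ℝ} (h : IsGraphOverTangent x ν U y₀ J lam)
include h

/-- Parseval in the orthonormal basis formed by the `J e_i` and `ν y₀`, with the normal term moved
to the right. -/
theorem sum_inner_mul_inner (a b : Euc (m + 1)) :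
    ∑ i, inner ℝ a (J (EuclideanSpace.single i 1)) * inner ℝ b (J (EuclideanSpace.single i 1)) =
      (inner ℝ a b : ℝ) - inner ℝ a (ν y₀) * inner ℝ b (ν y₀) := by
  obtain ⟨w, hw⟩ := h.mem_range (b - (inner ℝ b (ν y₀) : ℝ) • ν y₀) (by
    simp [inner_sub_left, inner_smul_left, h.unit y₀ h.mem])
  have hb : b = J w + (inner ℝ b (ν y₀) : ℝ) • ν y₀ := by rw [hw]; abel
  have h1 : ∀ u, inner ℝ b (J u) = (inner ℝ u w : ℝ) := fun u => by
    conv_lhs => rw [hb]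
    rw [inner_add_left, J.inner_map_map, inner_smul_left, real_inner_comm (J u) (ν y₀),
      h.inner_normal_range, real_inner_comm]
    simp
  have h2 : ∀ u, inner ℝ a (J u) = (inner ℝ (J.toContinuousLinearMap.adjoint a) u : ℝ) := fun u => by
    rw [ContinuousLinearMap.adjoint_inner_left]
    rfl
  have h3 := (EuclideanSpace.basisFun (Fin m) ℝ).sum_inner_mul_inner
    (J.toContinuousLinearMap.adjoint a) w
  simp only [EuclideanSpace.basisFun_apply] at h3
  simp only [h1, h2, h3]
  rw [← h2, hw, inner_sub_right, inner_smul_right]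
  ring

/-- The Laplacian of the position vector is `H ν`: the sum is normal, its normal component is the
mean curvature, and the curvature equation supplies the value of `H`. -/
theorem sum_fderiv2 : ∑ i, fderiv ℝ (fderiv ℝ x) y₀ (EuclideanSpace.single i 1)
    (EuclideanSpace.single i 1) = (lam - (1 / 2) * inner ℝ (x y₀) (ν y₀)) • ν y₀ := by
  have h1 : paramMeanCurvature x ν y₀ = ∑ i, inner ℝ (fderiv ℝ (fderiv ℝ x) y₀
      (EuclideanSpace.single i 1) (EuclideanSpace.single i 1)) (ν y₀) := by
    refine trace_inv_mul_eq_sum_inner _ _ _ (fun i => EuclideanSpace.single i 1) ?_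
    rw [h.fderiv_eq]
    exact EuclideanSpace.orthonormal_single.comp_linearIsometry J
  have h2 := h.curvature y₀ h.mem
  rw [h.eq_smul_normal (w := ∑ i, fderiv ℝ (fderiv ℝ x) y₀ (EuclideanSpace.single i 1)
    (EuclideanSpace.single i 1)) (fun u => by simp [sum_inner, h.inner_fderiv2 h.mem]),
    sum_inner, ← h1]
  congr 1
  linarith

theorem eventually_line_mem (e : Euc m) : ∀ᶠ t in 𝓝 (0 : ℝ), y₀ + t • e ∈ U := by
  have hc : ContinuousAt (fun t : ℝ => y₀ + t • e) 0 := by fun_prop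
  exact hc (by simpa using h.isOpen.mem_nhds h.mem)

/-- The inequality satisfied at a local minimum of `⟨ν, e⟩ + θ(|x - Q|²)`. -/
theorem nonneg_of_isLocalMin (e Q : Euc (m + 1)) {θ θ' : ℝ → ℝ} {θ'' : ℝ}
    (hθ : ∀ s, HasDerivAt θ (θ' s) s) (hθ' : HasDerivAt θ' θ'' (‖x y₀ - Q‖ ^ 2))
    (hmin : IsLocalMin (fun y => inner ℝ (ν y) e + θ (‖x y - Q‖ ^ 2)) y₀) :
    0 ≤ -(∑ i, ‖fderiv ℝ ν y₀ (EuclideanSpace.single i 1)‖ ^ 2) * inner ℝ (ν y₀) e +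
      θ' (‖x y₀ - Q‖ ^ 2) * (2 * m +
        2 * (lam - (1 / 2) * inner ℝ (x y₀) (ν y₀)) * inner ℝ (x y₀ - Q) (ν y₀) -
        (inner ℝ (x y₀) (x y₀ - Q) - inner ℝ (x y₀) (ν y₀) * inner ℝ (x y₀ - Q) (ν y₀))) +
      4 * θ'' * (‖x y₀ - Q‖ ^ 2 - inner ℝ (x y₀ - Q) (ν y₀) ^ 2) := by
  set b : Fin m → Euc m := fun i => EuclideanSpace.single i 1 with hb
  have hl : ∀ i (t : ℝ), HasDerivAt (fun t : ℝ => y₀ + t • b i) (b i) t := fun i t => by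
    simpa using ((hasDerivAt_id t).smul_const (b i)).const_add y₀
  have hx1 : ∀ i, ∀ᶠ t in 𝓝 (0 : ℝ), HasDerivAt (fun t : ℝ => x (y₀ + t • b i))
      (fderiv ℝ x (y₀ + t • b i) (b i)) t := fun i => by
    filter_upwards [h.eventually_line_mem (b i)] with t ht
    exact (h.hasFDerivAt ht).comp_hasDerivAt t (hl i t)
  have hn1 : ∀ i, ∀ᶠ t in 𝓝 (0 : ℝ), HasDerivAt (fun t : ℝ => ν (y₀ + t • b i))
      (fderiv ℝ ν (y₀ + t • b i) (b i)) t := fun i => by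
    filter_upwards [h.eventually_line_mem (b i)] with t ht
    exact (h.normal_hasFDerivAt ht).comp_hasDerivAt t (hl i t)
  have hx2 : ∀ i, HasDerivAt (fun t : ℝ => fderiv ℝ x (y₀ + t • b i) (b i))
      (fderiv ℝ (fderiv ℝ x) y₀ (b i) (b i)) 0 := fun i => by
    have h1 : HasFDerivAt (fun z => fderiv ℝ x z (b i)) (fderiv ℝ (fun z => fderiv ℝ x z (b i))
        (y₀ + (0 : ℝ) • b i)) (y₀ + (0 : ℝ) • b i) := by
      simpa using ((h.fderiv_apply_contDiffAt h.mem (b i)).differentiableAt (by simp)).hasFDerivAt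
    have h2 := h1.comp_hasDerivAt 0 (hl i 0)
    rw [zero_smul, add_zero, h.fderiv_fderiv_apply h.mem] at h2
    exact h2
  have hn2 : ∀ i, HasDerivAt (fun t : ℝ => fderiv ℝ ν (y₀ + t • b i) (b i))
      (fderiv ℝ (fun z => fderiv ℝ ν z (b i)) y₀ (b i)) 0 := fun i => by
    have h1 : HasFDerivAt (fun z => fderiv ℝ ν z (b i)) (fderiv ℝ (fun z => fderiv ℝ ν z (b i))
        (y₀ + (0 : ℝ) • b i)) (y₀ + (0 : ℝ) • b i) := by
      simpa using ((h.normal_fderiv_contDiffAt h.mem (b i)).differentiableAt (by simp)).hasFDerivAt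
    have h2 := h1.comp_hasDerivAt 0 (hl i 0)
    rw [zero_smul, add_zero] at h2
    exact h2
  set s₀ := ‖x y₀ - Q‖ ^ 2 with hs₀
  -- First and second order conditions for a minimum along each coordinate line. The `+ 1` is `‖J
  -- e_i‖²`, from the second derivative of `|x - Q|²`.
  have key : ∀ i, inner ℝ (fderiv ℝ ν y₀ (b i)) e + θ' s₀ * (2 * inner ℝ (x y₀ - Q) (J (b i))) = 0 ∧
      0 ≤ inner ℝ (fderiv ℝ (fun z => fderiv ℝ ν z (b i)) y₀ (b i)) e +
        (θ'' * (2 * inner ℝ (x y₀ - Q) (J (b i))) * (2 * inner ℝ (x y₀ - Q) (J (b i))) +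
        θ' s₀ * (2 * (inner ℝ (x y₀ - Q) (fderiv ℝ (fderiv ℝ x) y₀ (b i) (b i)) + 1))) := fun i => by
    have hm : IsLocalMin (fun t : ℝ => inner ℝ (ν (y₀ + t • b i)) e +
        θ (‖x (y₀ + t • b i) - Q‖ ^ 2)) 0 := by
      have hc : ContinuousAt (fun t : ℝ => y₀ + t • b i) 0 := by fun_prop
      have h1 : Filter.Tendsto (fun t : ℝ => y₀ + t • b i) (𝓝 0) (𝓝 y₀) := by
        simpa [ContinuousAt] using hc
      have := h1.eventually hmin
      simpa [IsLocalMin, IsMinFilter] using this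
    have hsq : ∀ᶠ t in 𝓝 (0 : ℝ), HasDerivAt (fun t : ℝ => ‖x (y₀ + t • b i) - Q‖ ^ 2)
        (2 * inner ℝ (x (y₀ + t • b i) - Q) (fderiv ℝ x (y₀ + t • b i) (b i))) t := by
      filter_upwards [hx1 i] with t ht
      exact (ht.sub_const Q).norm_sq
    have hu : ∀ᶠ t in 𝓝 (0 : ℝ), HasDerivAt (fun t : ℝ => inner ℝ (ν (y₀ + t • b i)) e +
        θ (‖x (y₀ + t • b i) - Q‖ ^ 2)) (inner ℝ (fderiv ℝ ν (y₀ + t • b i) (b i)) e +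
          θ' (‖x (y₀ + t • b i) - Q‖ ^ 2) *
            (2 * inner ℝ (x (y₀ + t • b i) - Q) (fderiv ℝ x (y₀ + t • b i) (b i)))) t := by
      filter_upwards [hsq, hn1 i] with t h1 h2
      have h3 := h2.inner ℝ (hasDerivAt_const t e)
      simp only [inner_zero_right, zero_add] at h3
      exact h3.add ((hθ _).comp t h1)
    have h1 := (hn2 i).inner ℝ (hasDerivAt_const 0 e)
    simp only [inner_zero_right, zero_add] at h1
    have h2 : HasDerivAt θ' θ'' (‖x (y₀ + (0 : ℝ) • b i) - Q‖ ^ 2) := by simpa using hθ'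
    have h3 := h2.comp 0 hsq.self_of_nhds
    have h4 := ((hx1 i).self_of_nhds.sub_const Q).inner ℝ (hx2 i)
    have hres := deriv_nonneg_of_isLocalMin hm hu (h1.add (h3.mul (h4.const_mul 2)))
    simp only [zero_smul, add_zero, h.fderiv_eq, LinearIsometry.coe_toContinuousLinearMap,
      Function.comp_apply, real_inner_self_eq_norm_sq, LinearIsometry.norm_map] at hres
    simpa [hb] using hres
  -- Subtracting multiples of the vanishing first derivatives costs nothing and turns the Laplacian
  -- into the drift Laplacian.
  have hsum : 0 ≤ ∑ i, ((inner ℝ (fderiv ℝ (fun z => fderiv ℝ ν z (b i)) y₀ (b i)) e +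
        (θ'' * (2 * inner ℝ (x y₀ - Q) (J (b i))) * (2 * inner ℝ (x y₀ - Q) (J (b i))) +
        θ' s₀ * (2 * (inner ℝ (x y₀ - Q) (fderiv ℝ (fderiv ℝ x) y₀ (b i) (b i)) + 1)))) -
        (1 / 2 * inner ℝ (x y₀) (J (b i))) * (inner ℝ (fderiv ℝ ν y₀ (b i)) e +
          θ' s₀ * (2 * inner ℝ (x y₀ - Q) (J (b i))))) := by
    refine Finset.sum_nonneg fun i _ => ?_
    rw [(key i).1, mul_zero, sub_zero]
    exact (key i).2
  have hN : ∑ i, (inner ℝ (fderiv ℝ (fun z => fderiv ℝ ν z (b i)) y₀ (b i)) e : ℝ) -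
      ∑ i, (1 / 2 * inner ℝ (x y₀) (J (b i))) * (inner ℝ (fderiv ℝ ν y₀ (b i)) e : ℝ) =
      -(∑ i, ‖fderiv ℝ ν y₀ (b i)‖ ^ 2) * inner ℝ (ν y₀) e := by
    have := congrArg (fun w => (inner ℝ w e : ℝ)) h.driftLaplacian_normal
    simpa [inner_sub_left, sum_inner, inner_smul_left, hb] using this
  have hX : ∑ i, (inner ℝ (x y₀ - Q) (fderiv ℝ (fderiv ℝ x) y₀ (b i) (b i)) : ℝ) =
      (lam - (1 / 2) * inner ℝ (x y₀) (ν y₀)) * inner ℝ (x y₀ - Q) (ν y₀) := by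
    rw [← inner_sum, h.sum_fderiv2, inner_smul_right]
  have hP := h.sum_inner_mul_inner (x y₀ - Q) (x y₀ - Q)
  have hP' := h.sum_inner_mul_inner (x y₀) (x y₀ - Q)
  rw [real_inner_self_eq_norm_sq, ← hs₀, ← sq] at hP
  refine hsum.trans_eq ?_
  rw [← hN, ← hP', ← hP]
  have hcard : (∑ _i : Fin m, (1 : ℝ)) = m := by simp
  rw [mul_assoc 2, ← hX, ← hcard]
  simp only [Finset.mul_sum, ← Finset.sum_add_distrib, ← Finset.sum_sub_distrib]
  refine Finset.sum_congr rfl fun i _ => ?_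
  ring

end IsGraphOverTangent

/-! ### The strong maximum principle -/

namespace IsLambdaHypersurface

variable {m : ℕ} {M : Type*} [TopologicalSpace M] [ChartedSpace (Euc m) M]
  [IsManifold (𝓡 m) ∞ M] {X N : M → Euc (m + 1)} {lam : ℝ}
  (hM : IsLambdaHypersurface X N lam)
include hM

/-- The inequality satisfied at a local minimum of `⟨N, e⟩ + θ(|X - Q|²)`; the number `a` is the
square of the norm of the second fundamental form. -/
theorem exists_nonneg_of_isLocalMin (p : M) (e Q : Euc (m + 1)) {θ θ' : ℝ → ℝ} {θ'' : ℝ}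
    (hθ : ∀ s, HasDerivAt θ (θ' s) s) (hθ' : HasDerivAt θ' θ'' (‖X p - Q‖ ^ 2))
    (hmin : IsLocalMin (fun q => inner ℝ (N q) e + θ (‖X q - Q‖ ^ 2)) p) :
    ∃ a : ℝ, 0 ≤ a ∧ (a = 0 → mfderiv (𝓡 m) (𝓡 (m + 1)) N p = 0) ∧
      0 ≤ -a * inner ℝ (N p) e + θ' (‖X p - Q‖ ^ 2) * (2 * m +
        2 * (lam - (1 / 2) * inner ℝ (X p) (N p)) * inner ℝ (X p - Q) (N p) -
        (inner ℝ (X p) (X p - Q) - inner ℝ (X p) (N p) * inner ℝ (X p - Q) (N p))) +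
      4 * θ'' * (‖X p - Q‖ ^ 2 - inner ℝ (X p - Q) (N p) ^ 2) := by
  obtain ⟨J, f, hp, hf, hJN, hg⟩ := hM.exists_isGraphOverTangent p
  have hfp := f.left_inv hp
  have hcont : Filter.Tendsto f.symm (𝓝 (f p)) (𝓝 p) := by
    have := f.continuousAt_symm (f.map_source hp)
    rwa [ContinuousAt, hfp] at this
  refine ⟨∑ i, ‖fderiv ℝ (N ∘ f.symm) (f p) (EuclideanSpace.single i 1)‖ ^ 2,
    Finset.sum_nonneg fun i _ => by positivity, fun ha => ?_, ?_⟩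
  · have h1 : ∀ i, fderiv ℝ (N ∘ f.symm) (f p) (EuclideanSpace.single i 1) = 0 := fun i => by
      have := (Finset.sum_eq_zero_iff_of_nonneg fun i _ => by positivity).mp ha i (Finset.mem_univ i)
      simpa using this
    have h2 : fderiv ℝ (N ∘ f.symm) (f p) = 0 := by
      ext1 u
      rw [eq_sum_smul_single u, map_sum]
      simp [h1]
    have h3 : N =ᶠ[𝓝 p] (N ∘ f.symm) ∘ fun q => J.toContinuousLinearMap.adjoint (X q) := by
      filter_upwards [f.open_source.mem_nhds hp] with q hq
      simp [← hf.proj q hq, f.left_inv hq]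
    have h4 : HasFDerivAt (N ∘ f.symm) (0 : Euc m →L[ℝ] Euc (m + 1))
        (J.toContinuousLinearMap.adjoint (X p)) := by
      rw [← hf.proj p hp, ← h2]
      exact ((hf.contDiffAt_comp_symm hM.normal_smooth
        (f.map_source hp)).differentiableAt (by simp)).hasFDerivAt
    have h5 := (h4.hasMFDerivAt.comp p
      (J.toContinuousLinearMap.adjoint.hasMFDerivAt.comp p (hM.hasMFDerivAt p)))
    have h6 := (h5.congr_of_eventuallyEq h3).mfderiv
    rw [h6]
    exact ContinuousLinearMap.zero_comp _
  · have h1 : IsLocalMin (fun y => inner ℝ ((N ∘ f.symm) y) e + θ (‖(X ∘ f.symm) y - Q‖ ^ 2))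
        (f p) := by
      have := hcont.eventually hmin
      simpa [IsLocalMin, IsMinFilter, hfp] using this
    have h2 := hg.nonneg_of_isLocalMin e Q hθ (by simpa [hfp] using hθ') h1
    simpa [hfp] using h2

/-- Near a point, secants of the hypersurface are not normal to it; in particular `X` is locally
injective. -/
theorem eventually_secant_not_normal (p : M) : ∃ U ∈ 𝓝 p, ∀ z ∈ U, ∀ q ∈ U, z ≠ q →
    (inner ℝ (X z - X q) (N z) : ℝ) ^ 2 < ‖X z - X q‖ ^ 2 := by
  obtain ⟨J, f, hp, hf, hJN, hg⟩ := hM.exists_isGraphOverTangent p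
  have hstrict : HasStrictFDerivAt (X ∘ f.symm) J.toContinuousLinearMap (f p) := by
    rw [← hg.fderiv_eq]
    exact (hg.contDiffAt hg.mem).hasStrictFDerivAt (by simp)
  -- With both errors bounded by `1/4`, and `d` the distance in the chart, a secant has length at
  -- least `3d/4` and normal component at most `d/4 + 5d/16 = 9d/16`.
  have h1 := hstrict.isLittleO.def (c := 1 / 4) (by norm_num)
  rw [nhds_prod_eq] at h1
  obtain ⟨W, hW, hW'⟩ := Filter.eventually_prod_self_iff'.mp h1
  have hN : ∀ᶠ z in 𝓝 p, ‖N z - N p‖ < 1 / 4 := by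
    have hc : Continuous fun z => ‖N z - N p‖ :=
      (hM.normal_smooth.continuous.sub continuous_const).norm
    exact hc.continuousAt.eventually_lt continuousAt_const (by simp)
  refine ⟨f.source ∩ f ⁻¹' W ∩ {z | ‖N z - N p‖ < 1 / 4}, Filter.inter_mem (Filter.inter_mem
    (f.open_source.mem_nhds hp) (f.continuousAt hp hW)) hN, ?_⟩
  rintro z ⟨⟨hzs, hzW⟩, hzN⟩ q ⟨⟨hqs, hqW⟩, -⟩ hzq
  have h2 := hW' (f z) hzW (f q) hqW
  simp only [Function.comp_apply, f.left_inv hzs, f.left_inv hqs,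
    LinearIsometry.coe_toContinuousLinearMap] at h2
  set d := ‖f z - f q‖ with hd
  have hd0 : 0 < d := norm_pos_iff.mpr (sub_ne_zero.mpr fun h => hzq (f.injOn hzs hqs h))
  set w := X z - X q with hw
  have hJd : ‖J (f z - f q)‖ = d := J.norm_map _
  have h3 : 3 / 4 * d ≤ ‖w‖ := by
    have := norm_sub_norm_le (J (f z - f q)) w
    rw [norm_sub_rev _ w] at this
    linarith
  have h4 : ‖w‖ ≤ 5 / 4 * d := by
    have := norm_sub_norm_le w (J (f z - f q))
    linarith
  have h5 : inner ℝ w (N z) = (inner ℝ (w - J (f z - f q)) (N p) : ℝ) + inner ℝ w (N z - N p) := by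
    rw [inner_sub_left w (J (f z - f q)), hJN, inner_sub_right]
    ring
  have h6 : |(inner ℝ (w - J (f z - f q)) (N p) : ℝ)| ≤ 1 / 4 * d := by
    refine (abs_real_inner_le_norm _ _).trans ?_
    rw [hM.normal_unit, mul_one]
    exact h2
  have h7 : |(inner ℝ w (N z - N p) : ℝ)| ≤ 5 / 4 * d * (1 / 4) := by
    refine (abs_real_inner_le_norm _ _).trans ?_
    exact mul_le_mul h4 (le_of_lt hzN) (norm_nonneg _) (by positivity)
  rw [sq_lt_sq, abs_of_nonneg (norm_nonneg w), h5]
  refine (abs_add_le _ _).trans_lt ?_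
  linarith

theorem isLocallyInjective : IsLocallyInjective X := by
  rw [isLocallyInjective_iff_nhds]
  intro p
  obtain ⟨U, hU, h⟩ := hM.eventually_secant_not_normal p
  refine ⟨U, hU, fun z hz q hq hzq => ?_⟩
  by_contra hne
  have := h z hz q hq hne
  simp [hzq] at this

/-- Hopf's barrier: `{⟨N, e⟩ > c}` cannot contain a punctured neighbourhood, in an ambient ball, of a
point of minimum at which the radius of the ball is not normal to the hypersurface. -/
theorem not_touching [T2Space M] {e : Euc (m + 1)} {c : ℝ} (hc0 : 0 ≤ c)
    (hc : ∀ q, c ≤ inner ℝ (N q) e) {O : Set M} (hO : IsOpen O) {z : M} (hzO : z ∈ O)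
    (hzc : inner ℝ (N z) e = c) {Q : Euc (m + 1)} {R : ℝ} (hzQr : ‖X z - Q‖ ^ 2 = R)
    (hzT : (inner ℝ (X z - Q) (N z) : ℝ) ^ 2 < ‖X z - Q‖ ^ 2)
    (hpos : ∀ y ∈ O, y ≠ z → ‖X y - Q‖ ^ 2 ≤ R → c < inner ℝ (N y) e) : False := by
  have hXc : Continuous X := hM.smooth.continuous
  have hNc : Continuous N := hM.normal_smooth.continuous
  have hVc : Continuous fun q => (inner ℝ (N q) e : ℝ) := hNc.inner continuous_const
  have : LocallyCompactSpace M := ChartedSpace.locallyCompactSpace (Euc m) M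
  -- `T` is the squared length of the tangential part of `X - Q`, so the squared gradient of `|X -
  -- Q|²` is `4T`; `L` below is the drift Laplacian of `|X - Q|²`.
  set T : M → ℝ := fun y => ‖X y - Q‖ ^ 2 - inner ℝ (X y - Q) (N y) ^ 2 with hT
  set L : M → ℝ := fun y => 2 * m +
        2 * (lam - (1 / 2) * inner ℝ (X y) (N y)) * inner ℝ (X y - Q) (N y) -
        (inner ℝ (X y) (X y - Q) - inner ℝ (X y) (N y) * inner ℝ (X y - Q) (N y)) with hL
  have hTc : Continuous T := by fun_prop
  have hLc : Continuous L := by fun_prop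
  have hTz : 0 < T z := sub_pos.mpr hzT
  set C := |L z| + 1 with hC
  have hC0 : 0 < C := by positivity
  set κ := T z / 2 with hκ
  have hκ0 : 0 < κ := by positivity
  -- Chosen so that `L - 4αT < 0` wherever `T > κ` and `L < C`: there `exp (-α|X - Q|²)` is strictly
  -- subharmonic for the drift Laplacian.
  set α := C / (4 * κ) with hα
  have hα0 : 0 < α := by positivity
  have hακ : 4 * α * κ = C := by rw [hα]; field_simp
  have hOpen : IsOpen ({y | κ < T y} ∩ {y | L y < C} ∩ O) :=
    ((isOpen_lt continuous_const hTc).inter (isOpen_lt hLc continuous_const)).inter hO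
  obtain ⟨K', hK', hzK', hK'O⟩ := exists_compact_subset hOpen (x := z)
    ⟨⟨by simp only [Set.mem_ofPred_eq]; linarith, by
      simp only [Set.mem_ofPred_eq]; have := le_abs_self (L z); linarith⟩, hzO⟩
  obtain ⟨c', hc', hBc'⟩ := ((hK'.diff isOpen_interior).inter_right (isClosed_le
    (f := fun y => ‖X y - Q‖ ^ 2) (g := fun _ => R) (by fun_prop)
    continuous_const)).exists_forall_le' hVc.continuousOn (a := c) (fun y hy =>
      hpos y (hK'O hy.1.1).2 (fun h => hy.1.2 (h ▸ hzK')) hy.2)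
  -- Half of the gap between `c` and the values of `⟨N, e⟩` on the part of `K' \ interior K'` inside
  -- the ball. On that part `w ≥ c' - ε = c + ε`, which exceeds `w z`.
  set ε := (c' - c) / 2 with hε
  have hε0 : 0 < ε := by rw [hε]; linarith
  set w : M → ℝ := fun y => inner ℝ (N y) e + -(ε * Real.exp (-α * ‖X y - Q‖ ^ 2)) with hw
  have hwc : Continuous w := by fun_prop
  obtain ⟨y, hyK', hymin⟩ := hK'.exists_isMinOn ⟨z, interior_subset hzK'⟩ hwc.continuousOn
  have hyz : w y ≤ w z := hymin (interior_subset hzK')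
  have hyint : y ∈ interior K' := by
    by_contra hyn
    simp only [hw, hzc, hzQr] at hyz
    have he1 : 0 < Real.exp (-α * (R)) := Real.exp_pos _
    by_cases hyr : ‖X y - Q‖ ^ 2 ≤ R
    · have h1 := hBc' y ⟨⟨hyK', hyn⟩, hyr⟩
      have h2 : Real.exp (-α * ‖X y - Q‖ ^ 2) ≤ 1 := by
        rw [Real.exp_le_one_iff]
        have := mul_nonneg hα0.le (sq_nonneg ‖X y - Q‖)
        linarith
      have h3 : 0 < ε * Real.exp (-α * (R)) := by positivity
      have h4 : ε * Real.exp (-α * ‖X y - Q‖ ^ 2) ≤ ε := by nlinarith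
      linarith
    -- Outside the ball the subtracted exponential is smaller than at `z`, so `⟨N, e⟩ ≥ c` is enough
    -- for `w > w z`.
    · push Not at hyr
      have h1 := hc y
      have h2 : Real.exp (-α * ‖X y - Q‖ ^ 2) < Real.exp (-α * (R)) := by
        rw [Real.exp_lt_exp]
        nlinarith
      nlinarith
  have hloc : IsLocalMin w y := hymin.isLocalMin (mem_interior_iff_mem_nhds.mp hyint)
  have hθ : ∀ s : ℝ, HasDerivAt (fun s : ℝ => -(ε * Real.exp (-α * s)))
      (ε * α * Real.exp (-α * s)) s := fun s => by
    have h1 : HasDerivAt (fun s : ℝ => -α * s) (-α) s := by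
      simpa using (hasDerivAt_id s).const_mul (-α)
    exact (h1.exp.const_mul ε).fun_neg.congr_deriv (by ring)
  have hθ' : ∀ s : ℝ, HasDerivAt (fun s : ℝ => ε * α * Real.exp (-α * s))
      (-(ε * α * α * Real.exp (-α * s))) s := fun s => by
    have h1 : HasDerivAt (fun s : ℝ => -α * s) (-α) s := by
      simpa using (hasDerivAt_id s).const_mul (-α)
    exact (h1.exp.const_mul (ε * α)).congr_deriv (by ring)
  obtain ⟨a, ha0, -, ha⟩ := hM.exists_nonneg_of_isLocalMin y e Q hθ (hθ' _) hloc
  obtain ⟨⟨hyT, hyL⟩, -⟩ := hK'O hyK'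
  simp only [Set.mem_ofPred_eq] at hyT hyL
  have h1 : 0 ≤ a * inner ℝ (N y) e := mul_nonneg ha0 (hc0.trans (hc y))
  set E := Real.exp (-α * ‖X y - Q‖ ^ 2) with hE
  have hE0 : 0 < ε * α * E := by positivity
  have h2 : L y - 4 * α * T y < 0 := by
    have := mul_lt_mul_of_pos_left hyT (by positivity : 0 < 4 * α)
    linarith
  have h3 : 0 ≤ ε * α * E * (L y - 4 * α * T y) := by
    have h4 : ε * α * E * (L y - 4 * α * T y) =
      ε * α * E * L y + 4 * (-(ε * α * α * E)) * T y := by ring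
    rw [h4]
    simp only [hL, hT]
    linarith
  exact absurd h3 (not_le.mpr (mul_neg_of_pos_of_neg hE0 h2))

/-- The local form of the strong maximum principle, with Hopf's barrier in the ambient space. -/
theorem eventually_eq_of_min [T2Space M] {e : Euc (m + 1)} {c : ℝ} (hc0 : 0 ≤ c)
    (hc : ∀ q, c ≤ inner ℝ (N q) e) {p : M} (hp : inner ℝ (N p) e = c) :
    ∀ᶠ q in 𝓝 p, inner ℝ (N q) e = c := by
  have hXc : Continuous X := hM.smooth.continuous
  have hNc : Continuous N := hM.normal_smooth.continuous
  have hVc : Continuous fun q => (inner ℝ (N q) e : ℝ) := hNc.inner continuous_const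
  have : LocallyCompactSpace M := ChartedSpace.locallyCompactSpace (Euc m) M
  obtain ⟨U, hU, hsec⟩ := hM.eventually_secant_not_normal p
  obtain ⟨K, hK, hpK, hKU⟩ := exists_compact_subset isOpen_interior (mem_interior_iff_mem_nhds.mpr hU)
  replace hKU : K ⊆ U := hKU.trans interior_subset
  have hinj : ∀ z ∈ K, ∀ q ∈ K, X z = X q → z = q := fun z hz q hq h => by
    by_contra hne
    have := hsec z (hKU hz) q (hKU hq) hne
    simp [h] at this
  have hpK' : p ∈ K := interior_subset hpK
  obtain ⟨δ, hδ, hδK⟩ := (hK.diff isOpen_interior).exists_forall_le'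
    (f := fun q => ‖X q - X p‖) (by fun_prop) (a := 0) (fun q hq => by
      rw [norm_pos_iff, sub_ne_zero]
      intro h
      exact hq.2 (hinj q hq.1 p hpK' h ▸ hpK))
  have hW : ∀ᶠ q in 𝓝 p, ‖X q - X p‖ < δ / 2 := by
    have hc : Continuous fun q => ‖X q - X p‖ := (hXc.sub continuous_const).norm
    exact hc.continuousAt.eventually_lt continuousAt_const (by simpa using half_pos hδ)
  filter_upwards [hW, mem_interior_iff_mem_nhds.mp hpK] with q hqδ hqK
  by_contra hq
  -- the zero of `⟨N, e⟩ - c` closest to `q` in the ambient space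
  obtain ⟨z, ⟨hzK, hzc⟩, hzmin⟩ := (hK.inter_right (isClosed_eq hVc continuous_const)).exists_isMinOn
    ⟨p, hpK', hp⟩ (f := fun y => ‖X y - X q‖) (by fun_prop)
  have hzc : inner ℝ (N z) e = c := hzc
  have hzmin' : ∀ y ∈ K, inner ℝ (N y) e = c → ‖X z - X q‖ ≤ ‖X y - X q‖ := fun y hy hyc =>
    hzmin ⟨hy, hyc⟩
  have hzq : z ≠ q := fun h => hq (h ▸ hzc)
  -- The minimizer is at ambient distance less than `δ` from `p`, being at least as close to `q` as
  -- `p` is, while points of `K` off its interior are at distance at least `δ`.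
  have hzint : z ∈ interior K := by
    by_contra h
    have h1 := hδK z ⟨hzK, h⟩
    have h2 := hzmin' p hpK' hp
    have h3 := norm_sub_le_norm_sub_add_norm_sub (X z) (X q) (X p)
    rw [norm_sub_rev (X p)] at h2
    linarith
  set r := ‖X z - X q‖ with hr
  -- The ball with diameter from `X q` to `X z` lies in the ball of radius `r` about `X q`, and
  -- meets its boundary sphere only at `X z`. Since `z` is a closest zero and `X` is injective on
  -- `K`, no other zero in `K` maps into this smaller ball.
  set Q : Euc (m + 1) := (1 / 2 : ℝ) • (X z + X q) with hQ
  have hpar : ∀ w : Euc (m + 1), ‖w - X q‖ ^ 2 + ‖w - X z‖ ^ 2 = 2 * ‖w - Q‖ ^ 2 + r ^ 2 / 2 := by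
    intro w
    have h1 : w - X q = (w - Q) + (1 / 2 : ℝ) • (X z - X q) := by rw [hQ]; module
    have h2 : w - X z = (w - Q) - (1 / 2 : ℝ) • (X z - X q) := by rw [hQ]; module
    have h3 := parallelogram_law_with_norm ℝ (w - Q) ((1 / 2 : ℝ) • (X z - X q))
    rw [h1, h2, hr]
    rw [norm_smul] at h3
    norm_num at h3
    nlinarith
  have hzQ : X z - Q = (1 / 2 : ℝ) • (X z - X q) := by rw [hQ]; module
  have hpos : ∀ y ∈ K, y ≠ z → ‖X y - Q‖ ^ 2 ≤ r ^ 2 / 4 → c < inner ℝ (N y) e := by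
    intro y hy hyz hyQ
    refine lt_of_le_of_ne (hc y) fun h => hyz ?_
    have h1 := hzmin' y hy h.symm
    have h2 := hpar (X y)
    have h3 : r ^ 2 ≤ ‖X y - X q‖ ^ 2 := pow_le_pow_left₀ (norm_nonneg _) h1 2
    have h4 : ‖X y - X z‖ ^ 2 ≤ 0 := by linarith
    have h5 : ‖X y - X z‖ = 0 := by
      have := sq_nonneg ‖X y - X z‖
      exact pow_eq_zero_iff (two_ne_zero) |>.mp (le_antisymm h4 this)
    exact hinj y hy z hzK (sub_eq_zero.mp (norm_eq_zero.mp h5))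
  refine hM.not_touching hc0 hc isOpen_interior hzint hzc (Q := Q) (R := r ^ 2 / 4) ?_ ?_
    fun y hy => hpos y (interior_subset hy)
  · rw [hzQ, norm_smul, hr]
    norm_num
    ring
  · have := hsec z (hKU hzK) q (hKU hqK) hzq
    simp only [hzQ, inner_smul_left, norm_smul]
    norm_num
    nlinarith

/-- The strong maximum principle for `⟨N, e⟩`. -/
theorem eq_of_min [T2Space M] [PreconnectedSpace M] {e : Euc (m + 1)} {c : ℝ} (hc0 : 0 ≤ c)
    (hc : ∀ q, c ≤ inner ℝ (N q) e) {p : M} (hp : inner ℝ (N p) e = c) (q : M) :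
    inner ℝ (N q) e = c := by
  have hVc : Continuous fun q => (inner ℝ (N q) e : ℝ) :=
    hM.normal_smooth.continuous.inner continuous_const
  have hclopen : IsClopen {q | (inner ℝ (N q) e : ℝ) = c} :=
    ⟨isClosed_eq hVc continuous_const, isOpen_iff_mem_nhds.mpr fun q hq =>
      hM.eventually_eq_of_min hc0 hc hq⟩
  have := hclopen.eq_univ ⟨p, hp⟩
  exact (Set.ext_iff.mp this q).mpr trivial

end IsLambdaHypersurface

/-! ### Functions with vanishing differential -/

section Constant

variable {m : ℕ} {M : Type*} [TopologicalSpace M] [ChartedSpace (Euc m) M]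
  [IsManifold (𝓡 m) ∞ M] {F : Type*} [NormedAddCommGroup F] [NormedSpace ℝ F]

theorem eq_of_mfderiv_eq_zero [PreconnectedSpace M] {G : M → F}
    (hG : ContMDiff (𝓡 m) 𝓘(ℝ, F) ∞ G) (h0 : ∀ p, mfderiv (𝓡 m) 𝓘(ℝ, F) G p = 0) (p q : M) :
    G p = G q := by
  have hloc : IsLocallyConstant G := by
    refine (IsLocallyConstant.iff_eventually_eq G).mpr fun p => ?_
    set φ := extChartAt (𝓡 m) p
    obtain ⟨δ, hδ, hball⟩ := Metric.mem_nhds_iff.mp (extChartAt_target_mem_nhds (I := 𝓡 m) p)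
    have hsm := contDiffOn_comp_extChartAt_symm hG p
    have hd : ∀ y ∈ Metric.ball (φ p) δ, fderiv ℝ (G ∘ φ.symm) y = 0 := fun y hy => by
      have h1 : ContMDiffAt 𝓘(ℝ, Euc m) (𝓡 m) ∞ φ.symm y :=
        (contMDiffOn_extChartAt_symm p).contMDiffAt
          ((isOpen_extChartAt_target p).mem_nhds (hball hy))
      have h2 := ((hG.mdifferentiable (by simp) (φ.symm y)).hasMFDerivAt.comp y
        (h1.mdifferentiableAt (by simp)).hasMFDerivAt).mfderiv
      rw [mfderiv_eq_fderiv, h0] at h2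
      exact h2.trans (ContinuousLinearMap.zero_comp _)
    have hconst : ∀ y ∈ Metric.ball (φ p) δ, (G ∘ φ.symm) y = (G ∘ φ.symm) (φ p) := fun y hy =>
      Metric.isOpen_ball.is_const_of_fderiv_eq_zero (convex_ball _ _).isPreconnected
        ((hsm.mono hball).differentiableOn (by simp)) hd hy (Metric.mem_ball_self hδ)
    filter_upwards [extChartAt_source_mem_nhds (I := 𝓡 m) p,
      (continuousAt_extChartAt (I := 𝓡 m) p) (Metric.ball_mem_nhds _ hδ)] with q hq hqb
    have := hconst (φ q) hqb
    rw [Function.comp_apply, Function.comp_apply, φ.left_inv hq,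
      φ.left_inv (mem_extChartAt_source p)] at this
    exact this
  exact hloc.apply_eq_of_preconnectedSpace p q

end Constant

/-! ### The case of a positive last component of the normal -/

namespace IsLambdaHypersurface

variable {m : ℕ} {M : Type*} [TopologicalSpace M] [ChartedSpace (Euc m) M]
  [IsManifold (𝓡 m) ∞ M] {X N : M → Euc (m + 1)} {lam : ℝ}
  (hM : IsLambdaHypersurface X N lam)
include hM

/-- If `⟨N, e⟩` is positive, it attains its minimum: `|X|²` is an exhaustion function which is
superharmonic for the drift Laplacian outside a compact set. -/
theorem exists_isMin [Nonempty M] (hproper : IsProperMap X) {e : Euc (m + 1)}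
    (hpos : ∀ q, 0 < (inner ℝ (N q) e : ℝ)) :
    ∃ p, ∀ q, (inner ℝ (N p) e : ℝ) ≤ inner ℝ (N q) e := by
  have hXc : Continuous X := hM.smooth.continuous
  have hNc : Continuous N := hM.normal_smooth.continuous
  have hVc : Continuous fun q => (inner ℝ (N q) e : ℝ) := hNc.inner continuous_const
  obtain ⟨p₀⟩ := ‹Nonempty M›
  -- The second entry makes `2m + 2 lam ⟨X, N⟩ - |X|²` negative where `|X| > R`; the first makes the
  -- set `|X| ≤ R` nonempty.
  set R := max ‖X p₀‖ (2 * m + 2 * |lam| + 1) with hR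
  have hR0 : 2 * m + 2 * |lam| + 1 ≤ R := le_max_right _ _
  have hR1 : 1 ≤ R := by have := abs_nonneg lam; have : (0 : ℝ) ≤ m := Nat.cast_nonneg m; linarith
  have hcomp : ∀ r, IsCompact {q | ‖X q‖ ≤ r} := fun r => by
    have := hproper.isCompact_preimage (isCompact_closedBall (0 : Euc (m + 1)) r)
    convert this using 1
    ext q
    simp
  obtain ⟨p, hpK, hpmin⟩ := (hcomp R).exists_isMinOn ⟨p₀, show ‖X p₀‖ ≤ R from le_max_left _ _⟩ hVc.continuousOn
  refine ⟨p, fun q => ?_⟩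
  by_contra! hq
  set c : ℝ := inner ℝ (N p) e with hc
  have hqR : R < ‖X q‖ := by
    by_contra! h
    exact absurd (hpmin h) (not_le.mpr hq)
  have hqR2 : R ^ 2 < ‖X q‖ ^ 2 := by gcongr
  -- With this choice `w q = (c + ⟨N q, e⟩)/2 + εR²` is below `c + εR²`, a lower bound of `w` on the
  -- inner sphere `|X| = R`.
  set ε := (c - inner ℝ (N q) e) / (2 * (‖X q‖ ^ 2 - R ^ 2)) with hε
  have hε0 : 0 < ε := div_pos (by linarith) (by linarith)
  have hεq : ε * (‖X q‖ ^ 2 - R ^ 2) = (c - inner ℝ (N q) e) / 2 := by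
    have : ‖X q‖ ^ 2 - R ^ 2 ≠ 0 := by linarith
    rw [hε]
    field_simp
  -- Large enough that `ε R'²` alone exceeds `w q`, so the minimum of `w` over the shell is not on
  -- the outer sphere either.
  set R' := ‖X q‖ + c / ε with hR'
  have hcε : 0 < c / ε := div_pos (hpos p) hε0
  have hR'q : ‖X q‖ ≤ R' := by linarith
  have hR'c : c + ε * R ^ 2 ≤ ε * R' ^ 2 := by
    have h1 : ε * (c / ε) = c := by field_simp
    have h2 : R ^ 2 + c / ε ≤ R' ^ 2 := by rw [hR']; nlinarith
    nlinarith
  set w : M → ℝ := fun y => inner ℝ (N y) e + ε * ‖X y - 0‖ ^ 2 with hw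
  have hwc : Continuous w := by fun_prop
  have hcK : IsCompact ({y | ‖X y‖ ≤ R'} ∩ {y | R ≤ ‖X y‖}) :=
    (hcomp R').inter_right (isClosed_le continuous_const hXc.norm)
  obtain ⟨y, ⟨hyR', hyR⟩, hymin⟩ := hcK.exists_isMinOn ⟨q, hR'q, hqR.le⟩ hwc.continuousOn
  simp only [Set.mem_ofPred_eq] at hyR hyR'
  have hyq : w y ≤ w q := hymin ⟨hR'q, hqR.le⟩
  have hwq : w q < c + ε * R ^ 2 := by
    simp only [hw, sub_zero]
    nlinarith
  have hy1 : R < ‖X y‖ := by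
    refine lt_of_le_of_ne hyR fun h => ?_
    have h1 : c ≤ inner ℝ (N y) e := hpmin (show ‖X y‖ ≤ R from h.ge)
    simp only [hw, sub_zero, ← h] at hyq hwq
    linarith
  have hy2 : ‖X y‖ < R' := by
    refine lt_of_le_of_ne hyR' fun h => ?_
    have h1 := hpos y
    simp only [hw, sub_zero, h] at hyq hwq
    linarith
  have hloc : IsLocalMin w y := by
    refine hymin.isLocalMin (Filter.inter_mem ?_ ?_)
    · exact Filter.mem_of_superset ((isOpen_lt hXc.norm continuous_const).mem_nhds hy2)
        fun z hz => show ‖X z‖ ≤ R' from le_of_lt hz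
    · exact Filter.mem_of_superset ((isOpen_lt continuous_const hXc.norm).mem_nhds hy1)
        fun z hz => show R ≤ ‖X z‖ from le_of_lt hz
  obtain ⟨a, ha0, -, ha⟩ := hM.exists_nonneg_of_isLocalMin y e 0 (θ := fun s => ε * s)
    (θ' := fun _ => ε) (θ'' := 0) (fun s => by simpa using (hasDerivAt_id s).const_mul ε)
    (hasDerivAt_const _ _) hloc
  simp only [sub_zero, mul_zero, zero_mul, add_zero, real_inner_self_eq_norm_sq] at ha
  set t := ‖X y‖ with ht
  set i : ℝ := inner ℝ (X y) (N y) with hi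
  have h1 : |i| ≤ t := by
    have := abs_real_inner_le_norm (X y) (N y)
    rwa [hM.normal_unit, mul_one] at this
  have h2 : lam * i ≤ |lam| * t := by
    refine (le_abs_self _).trans ?_
    rw [abs_mul]
    gcongr
  have h3 : 0 ≤ a * inner ℝ (N y) e := mul_nonneg ha0 (hpos y).le
  have h4 : 2 * m + 2 * (lam - 1 / 2 * i) * i - (t ^ 2 - i * i) < 0 := by
    have h5 : (2 * m + 2 * |lam| + 1) * t < t * t :=
      mul_lt_mul_of_pos_right (hR0.trans_lt hy1) (by linarith)
    have h6 : 2 * (m : ℝ) * 1 ≤ 2 * m * t := by gcongr; linarith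
    nlinarith
  nlinarith [mul_neg_of_pos_of_neg hε0 h4]

/-- If `⟨N, e⟩` is positive then `N` is constant. -/
theorem normal_eq_of_pos [T2Space M] [ConnectedSpace M] (hproper : IsProperMap X)
    {e : Euc (m + 1)} (hpos : ∀ q, 0 < (inner ℝ (N q) e : ℝ)) (p q : M) : N p = N q := by
  obtain ⟨p₀, hp₀⟩ := hM.exists_isMin hproper hpos
  have hconst := hM.eq_of_min (hpos p₀).le hp₀ rfl
  refine eq_of_mfderiv_eq_zero hM.normal_smooth (fun r => ?_) p q
  -- Since `⟨N, e⟩` is now constant, every point is a local minimum, and the inequality with `θ = 0`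
  -- reads `0 ≤ -|A|² ⟨N, e⟩`.
  obtain ⟨a, ha0, hadN, ha⟩ := hM.exists_nonneg_of_isLocalMin r e 0 (θ := fun _ => 0)
    (θ' := fun _ => 0) (θ'' := 0) (fun s => hasDerivAt_const _ _) (hasDerivAt_const _ _)
    (Filter.Eventually.of_forall fun s => by simp [hconst])
  simp only [zero_mul, mul_zero, add_zero] at ha
  refine hadN (le_antisymm ?_ ha0)
  by_contra! h
  nlinarith [mul_pos h (hpos r)]

end IsLambdaHypersurface

/-! ### Lifting affine subspaces tangent to the hypersurface -/

section Translation

variable {m : ℕ} {M : Type*} [TopologicalSpace M] [ChartedSpace (Euc m) M]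
  {X N : M → Euc (m + 1)} {lam : ℝ}

/-- Near a point, the hypersurface contains its translates by the vectors tangent to it
everywhere. -/
theorem IsProjectionChart.exists_translation {E' : Type*} [NormedAddCommGroup E']
    [NormedSpace ℝ E'] [FiniteDimensional ℝ E'] (hE : Module.finrank ℝ E' = m)
    {π : Euc (m + 1) →L[ℝ] E'} {f : OpenPartialHomeomorph M E'} (hf : IsProjectionChart X π f)
    (hM : IsLambdaHypersurface X N lam) {p : M} (hp : p ∈ f.source) :
    ∃ ρ > 0, ∃ U ∈ 𝓝 p, U ⊆ f.source ∧ ∀ q ∈ U, ∀ w : Euc (m + 1), ‖w‖ < ρ →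
      (∀ r, inner ℝ w (N r) = 0) →
      f q + π w ∈ f.target ∧ X (f.symm (f q + π w)) = X q + w := by
  obtain ⟨δ, hδ, hball⟩ := Metric.isOpen_iff.mp f.open_target (f p) (f.map_source hp)
  refine ⟨δ / 2 / (‖π‖ + 1), by positivity, f.source ∩ f ⁻¹' Metric.ball (f p) (δ / 2),
    Filter.inter_mem (f.open_source.mem_nhds hp)
      (f.continuousAt hp (Metric.ball_mem_nhds _ (by positivity))), Set.inter_subset_left, ?_⟩
  rintro q ⟨hqs, hqb⟩ w hw hwN
  have hπw : ‖π w‖ < δ / 2 := by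
    refine (π.le_opNorm w).trans_lt ?_
    rw [lt_div_iff₀ (by positivity)] at hw
    have := norm_nonneg w
    nlinarith
  have hmem : ∀ t ∈ Set.Icc (0 : ℝ) 1, f q + t • π w ∈ f.target := fun t ht => by
    refine hball ?_
    have h1 : dist (f q) (f p) < δ / 2 := hqb
    rw [Metric.mem_ball, dist_eq_norm]
    rw [dist_eq_norm] at h1
    have h2 : ‖t • π w‖ ≤ ‖π w‖ := by
      rw [norm_smul, Real.norm_of_nonneg ht.1]
      exact mul_le_of_le_one_left (norm_nonneg _) ht.2
    calc ‖f q + t • π w - f p‖ = ‖(f q - f p) + t • π w‖ := by congr 1; abel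
      _ ≤ ‖f q - f p‖ + ‖t • π w‖ := norm_add_le _ _
      _ < δ := by linarith
  -- Because `w` is tangent at every point, the image of the chart segment in direction `π w` has
  -- velocity exactly `w`, hence is a straight segment in the ambient space.
  have hder : ∀ t ∈ Set.Icc (0 : ℝ) 1, HasDerivAt
      (fun t : ℝ => (X ∘ f.symm) (f q + t • π w) - t • w) 0 t := fun t ht => by
    have h1 : HasDerivAt (fun t : ℝ => f q + t • π w) (π w) t := by
      simpa using ((hasDerivAt_id t).smul_const (π w)).const_add (f q)
    have h2 := ((hf.contDiffAt_comp_symm hM.smooth (hmem t ht)).differentiableAt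
      (by simp)).hasFDerivAt.comp_hasDerivAt t h1
    rw [hf.fderiv_proj hM hE (hmem t ht) (hwN _)] at h2
    have h3 : HasDerivAt (fun t : ℝ => t • w) w t := by
      simpa using (hasDerivAt_id t).smul_const w
    simpa using h2.fun_sub h3
  have h1 := constant_of_has_deriv_right_zero
    (fun t ht => (hder t ht).continuousAt.continuousWithinAt)
    (fun t ht => (hder t ⟨ht.1, ht.2.le⟩).hasDerivWithinAt) 1 (by simp)
  have h2 := hmem 1 (by simp)
  simp only [one_smul, zero_smul, add_zero, sub_zero, Function.comp_apply, f.left_inv hqs] at h1 h2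
  exact ⟨h2, by rw [← h1]; abel⟩

namespace IsLambdaHypersurface

variable [IsManifold (𝓡 m) ∞ M] (hM : IsLambdaHypersurface X N lam)
include hM

/-- If the vectors of `W` are tangent to the hypersurface everywhere, the affine subspaces parallel
to `W` through points of the hypersurface lift to `M`. -/
theorem exists_lift [T2Space M] (hproper : IsProperMap X) (W : Submodule ℝ (Euc (m + 1)))
    (hW : ∀ w ∈ W, ∀ r, inner ℝ w (N r) = 0) (p : M) :
    ∃ c : W → M, Continuous c ∧ c 0 = p ∧ ∀ w, X (c w) = X p + w := by
  have hXc : Continuous X := hM.smooth.continuous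
  -- The preimage of the affine subspace `X p + W`. The map `τ` on it is shown to be a covering of
  -- `W`, and `c` will be a section of it.
  let A : Set M := {q | X q - X p ∈ W}
  have hAc : IsClosed A := (W.closed_of_finiteDimensional).preimage (hXc.sub continuous_const)
  let τ : A → W := fun a => ⟨X a - X p, a.2⟩
  have hτc : Continuous τ := by
    refine Continuous.subtype_mk ?_ _
    exact (hXc.comp continuous_subtype_val).sub continuous_const
  have hτp : IsProperMap τ := by
    refine isProperMap_of_comp_of_inj hτc continuous_subtype_val ?_ Subtype.val_injective
    have h1 : IsProperMap fun x : Euc (m + 1) => x - X p :=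
      (Homeomorph.subRight (X p)).isProperMap
    exact (h1.comp hproper).comp hAc.isClosedEmbedding_subtypeVal.isProperMap
  have hτo : IsOpenMap τ := by
    refine IsOpenMap.of_nhds_le fun a => ?_
    obtain ⟨J, f, ha, hf, -, -⟩ := hM.exists_isGraphOverTangent (a : M)
    obtain ⟨ρ, hρ, U, hU, hUs, hUt⟩ := hf.exists_translation (by simp) hM ha
    have haU := mem_of_mem_nhds hU
    set π := J.toContinuousLinearMap.adjoint with hπ
    -- A local section of `τ` through `a`, obtained by translating inside the chart; it makes `τ`
    -- open.
    let σ : W → M := fun w => f.symm (f a + π (w - τ a : W))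
    have hσa : σ (τ a) = a := by simp [σ, f.left_inv ha]
    have hσc : ContinuousAt σ (τ a) := by
      have h1 : ContinuousAt (fun w : W => f a + π (w - τ a : W)) (τ a) := by fun_prop
      refine ContinuousAt.comp (g := f.symm) ?_ h1
      simpa using f.continuousAt_symm (f.map_source ha)
    have hσX : ∀ᶠ w in 𝓝 (τ a), X (σ w) = X p + w := by
      have h1 : ∀ᶠ w in 𝓝 (τ a), ‖((w - τ a : W) : Euc (m + 1))‖ < ρ := by
        have h2 : Continuous fun w : W => ‖((w - τ a : W) : Euc (m + 1))‖ := by fun_prop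
        exact h2.continuousAt.eventually_lt continuousAt_const (by simpa using hρ)
      filter_upwards [h1] with w hw
      rw [(hUt a haU _ hw (hW _ (w - τ a).2)).2]
      simp only [τ, AddSubgroupClass.coe_sub]
      abel
    intro S hS
    rw [Filter.mem_map, nhds_subtype_eq_comap, Filter.mem_comap] at hS
    obtain ⟨S', hS', hSS⟩ := hS
    have h1 : ∀ᶠ w in 𝓝 (τ a), σ w ∈ S' := hσc (by rwa [hσa])
    filter_upwards [h1, hσX] with w hw1 hw2
    have hwA : σ w ∈ A := by
      change X (σ w) - X p ∈ W
      rw [hw2, add_sub_cancel_left]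
      exact w.2
    have h3 : (⟨σ w, hwA⟩ : A) ∈ τ ⁻¹' S := hSS hw1
    have h4 : τ ⟨σ w, hwA⟩ = w := by
      ext1
      simp [τ, hw2]
    rwa [Set.mem_preimage, h4] at h3
  have hτl : IsLocalHomeomorph τ := by
    refine isLocalHomeomorph_iff_isOpenEmbedding_restrict.mpr fun a => ?_
    obtain ⟨U, hUo, haU, hU⟩ := hM.isLocallyInjective (a : M)
    have hVo : IsOpen (Subtype.val ⁻¹' U : Set A) := hUo.preimage continuous_subtype_val
    refine ⟨Subtype.val ⁻¹' U, hVo.mem_nhds haU,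
      Topology.IsOpenEmbedding.of_continuous_injective_isOpenMap
        (hτc.comp continuous_subtype_val) ?_ (hτo.domRestrict hVo)⟩
    rintro ⟨b, hb⟩ ⟨c, hc⟩ hbc
    have h1 : X b - X p = X c - X p := congrArg Subtype.val hbc
    exact Subtype.ext (Subtype.ext (hU hb hc (sub_left_injective h1)))
  -- A proper local homeomorphism has compact discrete, hence finite, fibres and is a closed map,
  -- which together give a covering. The identity of the simply connected `W` then lifts.
  have hcov : IsCoveringMap τ := by
    rw [isCoveringMap_iff_isCoveringMapOn_univ]
    refine hτp.isClosedMap.isCoveringMapOn_of_isLocalHomeomorphOn (fun w _ => ?_)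
      hτl.isLocalHomeomorphOn
    refine (hτp.isCompact_preimage isCompact_singleton).finite
      (hτl.isLocalHomeomorphOn.isDiscrete_of_image ?_)
    exact ((Set.finite_singleton w).subset (Set.image_preimage_subset _ _)).isDiscrete
  obtain ⟨c, ⟨hc0, hc⟩, -⟩ := hcov.existsUnique_continuousMap_lifts (ContinuousMap.id W) 0
    ⟨p, show X p - X p ∈ W by simp⟩ (by ext1; simp [τ])
  refine ⟨fun w => (c w : M), continuous_subtype_val.comp c.continuous, by simp [hc0], fun w => ?_⟩
  have h1 : (τ (c w) : Euc (m + 1)) = w := congrArg Subtype.val (congrFun hc w)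
  rw [← h1]
  simp [τ]

/-- A proper hypersurface with constant normal is a hyperplane. -/
theorem isHyperplane_of_normal_eq [T2Space M] [ConnectedSpace M] (hproper : IsProperMap X)
    (hN : ∀ p q, N p = N q) : IsHyperplane X := by
  have hXc : Continuous X := hM.smooth.continuous
  obtain ⟨p⟩ : Nonempty M := inferInstance
  set v := N p with hv
  have hW : ∀ w ∈ (ℝ ∙ v)ᗮ, ∀ r, inner ℝ w (N r) = 0 := fun w hw r => by
    rw [hN r p]
    exact mem_orthogonal_span_singleton_iff.mp hw
  obtain ⟨c, hcc, hc0, hc⟩ := hM.exists_lift hproper (ℝ ∙ v)ᗮ hW p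
  have hconst : ∀ q, (inner ℝ v (X q) : ℝ) = inner ℝ v (X p) := fun q => by
    have hs : ContMDiff (𝓡 m) 𝓘(ℝ, ℝ) ∞ fun q => (innerSL ℝ v) (X q) :=
      (innerSL ℝ v).contMDiff.comp hM.smooth
    refine eq_of_mfderiv_eq_zero hs (fun r => ?_) q p
    have h1 := ((innerSL ℝ v).hasMFDerivAt.comp r (hM.hasMFDerivAt r)).mfderiv
    refine h1.trans (ContinuousLinearMap.ext fun u => ?_)
    have h2 := hM.normal_orthogonal r u
    rw [hN r p, real_inner_comm] at h2
    exact h2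
  let g : M → (ℝ ∙ v)ᗮ := fun q => ⟨X q - X p, by
    rw [mem_orthogonal_span_singleton_iff, real_inner_comm, inner_sub_right, hconst, sub_self]⟩
  have hgc : Continuous g := (hXc.sub continuous_const).subtype_mk _
  -- Both sides lift `X` through `X` and agree at `p`; local injectivity of `X` and connectedness of
  -- `M` make lifts unique. Injectivity of `X` follows because `g` depends on `X` only.
  have hcg : c ∘ g = id := by
    refine (T2Space.isSeparatedMap X).eq_of_comp_eq hM.isLocallyInjective (hcc.comp hgc)
      continuous_id ?_ p ?_
    · ext1 q
      simp [hc, g]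
    · have : g p = 0 := by ext1; simp [g]
      simp [this, hc0]
  have hinj : Function.Injective X := fun q r hqr => by
    have h1 : g q = g r := Subtype.ext (by simp [g, hqr])
    have h2 : ∀ q, c (g q) = q := fun q => congrFun hcg q
    rw [← h2 q, h1, h2]
  refine ⟨(Topology.IsClosedEmbedding.of_continuous_injective_isClosedMap hXc hinj
    hproper.isClosedMap).isEmbedding, v, inner ℝ v (X p), hM.normal_unit p, ?_⟩
  ext x
  constructor
  · rintro ⟨q, rfl⟩
    exact hconst q
  · intro hx
    have hx : (inner ℝ v x : ℝ) = inner ℝ v (X p) := hx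
    refine ⟨c ⟨x - X p, ?_⟩, ?_⟩
    · rw [mem_orthogonal_span_singleton_iff, real_inner_comm, inner_sub_right, hx, sub_self]
    · rw [hc]
      simp

end IsLambdaHypersurface

end Translation

/-! ### The translation flow and its smoothness -/

namespace IsLambdaHypersurface

variable {m : ℕ} {M : Type*} [TopologicalSpace M] [ChartedSpace (Euc m) M]
  {X N : M → Euc (m + 1)} {lam : ℝ}

/-- The translation flow in the direction `e` on a hypersurface to which `e` is tangent
everywhere. -/
structure IsTranslationFlow (X : M → Euc (m + 1)) (e : Euc (m + 1)) (φ : M × ℝ → M) : Prop where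
  continuous_right : ∀ p, Continuous fun t => φ (p, t)
  zero : ∀ p, φ (p, 0) = p
  translate : ∀ p t, X (φ (p, t)) = X p + t • e

variable [IsManifold (𝓡 m) ∞ M] [T2Space M] (hM : IsLambdaHypersurface X N lam)
include hM

theorem exists_isTranslationFlow (hproper : IsProperMap X) {e : Euc (m + 1)}
    (he : ∀ r, inner ℝ e (N r) = 0) : ∃ φ : M × ℝ → M, IsTranslationFlow X e φ := by
  have hW : ∀ w ∈ (ℝ ∙ e), ∀ r, inner ℝ w (N r) = 0 := fun w hw r => by
    obtain ⟨t, rfl⟩ := Submodule.mem_span_singleton.mp hw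
    rw [inner_smul_left, he, mul_zero]
  choose c hcc hc0 hc using hM.exists_lift hproper (ℝ ∙ e) hW
  let ℓ : ℝ → (ℝ ∙ e) := fun t => ⟨t • e, Submodule.mem_span_singleton.mpr ⟨t, rfl⟩⟩
  have hℓ : Continuous ℓ := (continuous_id.smul continuous_const).subtype_mk _
  have hℓ0 : ℓ 0 = 0 := by ext1; simp [ℓ]
  exact ⟨fun x => c x.1 (ℓ x.2), fun p => (hcc p).comp hℓ, fun p => by simp [hℓ0, hc0],
    fun p t => by simp [hc, ℓ]⟩

namespace IsTranslationFlow

variable {e : Euc (m + 1)} {φ : M × ℝ → M} (hφ : IsTranslationFlow X e φ)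
include hφ

/-- Since `X` is locally injective, a path in `M` over the line `X p + t • e` is determined by its
starting point. Both the group law and the local formula for the flow rest on this. -/
theorem eqOn_of_lift {s : Set ℝ} (hs : IsPreconnected s) (h0 : (0 : ℝ) ∈ s) {p : M} {g : ℝ → M}
    (hg : ContinuousOn g s) (hg0 : g 0 = p) (hgX : ∀ t ∈ s, X (g t) = X p + t • e) :
    ∀ t ∈ s, φ (p, t) = g t :=
  (T2Space.isSeparatedMap X).eqOn_of_comp_eqOn hM.isLocallyInjective hs
    (hφ.continuous_right p).continuousOn hg
    (fun t ht => by simp [hφ.translate, hgX t ht]) h0 (by simp [hφ.zero, hg0])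

theorem add (p : M) (s t : ℝ) : φ (φ (p, s), t) = φ (p, s + t) := by
  refine hφ.eqOn_of_lift hM (s := Set.univ) isPreconnected_univ trivial
    (g := fun t => φ (p, s + t)) ?_ (by simp) (fun t _ => ?_) t trivial
  · exact ((hφ.continuous_right p).comp (continuous_const.add continuous_id)).continuousOn
  · rw [hφ.translate, hφ.translate, add_smul, add_assoc]

/-- By uniqueness of lifts the flow is, for small times, a straight translation read in a projection
chart, which is jointly smooth. The time bound is uniform over a neighbourhood of `p`. -/
theorem exists_contMDiffAt (he : ∀ r, inner ℝ e (N r) = 0) (he1 : ‖e‖ = 1) (p : M) :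
    ∃ ρ > 0, ∃ U : Set M, IsOpen U ∧ p ∈ U ∧ ∀ q ∈ U, ∀ t : ℝ, |t| < ρ →
      ContMDiffAt ((𝓡 m).prod 𝓘(ℝ, ℝ)) (𝓡 m) ∞ φ (q, t) := by
  obtain ⟨J, f, hp, hf, -, -⟩ := hM.exists_isGraphOverTangent p
  obtain ⟨ρ, hρ, U, hU, hUs, hUt⟩ := hf.exists_translation (by simp) hM hp
  set π := J.toContinuousLinearMap.adjoint with hπ
  have hlt : ∀ t : ℝ, |t| < ρ → ‖t • e‖ < ρ := fun t ht => by
    rwa [norm_smul, he1, mul_one, Real.norm_eq_abs]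
  have hperp : ∀ (t : ℝ) r, inner ℝ (t • e) (N r) = 0 := fun t r => by
    rw [inner_smul_left, he, mul_zero]
  have hloc : ∀ q ∈ U, ∀ t ∈ Metric.ball (0 : ℝ) ρ, φ (q, t) = f.symm (π (X q) + π (t • e)) := by
    intro q hq
    have hball : ∀ t ∈ Metric.ball (0 : ℝ) ρ, |t| < ρ := fun t ht => by simpa using ht
    refine hφ.eqOn_of_lift hM (convex_ball _ _).isPreconnected (Metric.mem_ball_self hρ)
      (fun t ht => ?_) ?_ (fun t ht => ?_)
    · rw [← hf.proj q (hUs hq)]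
      refine ContinuousAt.continuousWithinAt (ContinuousAt.comp (g := f.symm)
        (f.continuousAt_symm (hUt q hq _ (hlt t (hball t ht)) (hperp t)).1) ?_)
      fun_prop
    · rw [← hf.proj q (hUs hq)]
      simp [f.left_inv (hUs hq)]
    · rw [← hf.proj q (hUs hq)]
      exact (hUt q hq _ (hlt t (hball t ht)) (hperp t)).2
  refine ⟨ρ, hρ, interior U, isOpen_interior, mem_interior_iff_mem_nhds.mpr hU, fun q hq t ht => ?_⟩
  have hev : φ =ᶠ[𝓝 (q, t)] fun x => f.symm (π (X x.1) + π (x.2 • e)) := by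
    have h1 : interior U ×ˢ Metric.ball (0 : ℝ) ρ ∈ 𝓝 (q, t) :=
      (isOpen_interior.prod Metric.isOpen_ball).mem_nhds ⟨hq, by simpa using ht⟩
    filter_upwards [h1] with x hx
    exact hloc x.1 (interior_subset hx.1) x.2 hx.2
  refine ContMDiffAt.congr_of_eventuallyEq ?_ hev
  have h1 : ContMDiff ((𝓡 m).prod 𝓘(ℝ, ℝ)) 𝓘(ℝ, Euc m) ∞
      fun x : M × ℝ => π (X x.1) + π (x.2 • e) := by
    have h2 : ContMDiff ((𝓡 m).prod 𝓘(ℝ, ℝ)) 𝓘(ℝ, Euc m) ∞ fun x : M × ℝ => π (X x.1) :=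
      π.contMDiff.comp (hM.smooth.comp contMDiff_fst)
    have h3 : ContMDiff ((𝓡 m).prod 𝓘(ℝ, ℝ)) 𝓘(ℝ, Euc m) ∞ fun x : M × ℝ => π (x.2 • e) :=
      π.contMDiff.comp (contMDiff_snd.smul contMDiff_const)
    exact h2.add h3
  have h2 := (hUt q (interior_subset hq) _ (hlt t ht) (hperp t)).1
  rw [hf.proj q (hUs (interior_subset hq))] at h2
  exact (hf.smoothAt_symm h2).comp (q, t) h1.contMDiffAt

theorem contMDiff (he : ∀ r, inner ℝ e (N r) = 0) (he1 : ‖e‖ = 1) :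
    ContMDiff ((𝓡 m).prod 𝓘(ℝ, ℝ)) (𝓡 m) ∞ φ := by
  rintro ⟨p, t⟩
  set A : Set ℝ := {t | ContMDiffAt ((𝓡 m).prod 𝓘(ℝ, ℝ)) (𝓡 m) ∞ φ (p, t)} with hA
  -- Smoothness propagates in time through `φ(x, t) = φ(φ(x, t₁), t - t₁)`; the short-time result
  -- applies at the point `φ(p, t₁)`, close to `φ(p, t₀)`. Hence `A` is open and closed.
  have hstep : ∀ t₀ : ℝ, ∃ η > 0, ∀ t₁ ∈ Metric.ball t₀ η, ∀ t₂ ∈ Metric.ball t₀ η,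
      t₁ ∈ A → t₂ ∈ A := by
    intro t₀
    obtain ⟨ρ, hρ, U, hUo, hU, hsm⟩ := hφ.exists_contMDiffAt hM he he1 (φ (p, t₀))
    obtain ⟨η, hη, hηU⟩ := Metric.mem_nhds_iff.mp
      ((hφ.continuous_right p).continuousAt (hUo.mem_nhds hU))
    refine ⟨min η (ρ / 2), by positivity, fun t₁ ht₁ t₂ ht₂ hA₁ => ?_⟩
    rw [Metric.mem_ball, lt_min_iff, Real.dist_eq] at ht₁ ht₂
    have h12 : |t₂ - t₁| < ρ := by
      have := abs_sub_le t₂ t₀ t₁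
      rw [abs_sub_comm t₀ t₁] at this
      linarith [ht₁.2, ht₂.2]
    have h1 : ContMDiffAt ((𝓡 m).prod 𝓘(ℝ, ℝ)) (𝓡 m) ∞ φ (φ (p, t₁), t₂ - t₁) :=
      hsm _ (hηU (show dist t₁ t₀ < η from ht₁.1)) _ h12
    have h2 : ContMDiffAt ((𝓡 m).prod 𝓘(ℝ, ℝ)) ((𝓡 m).prod 𝓘(ℝ, ℝ)) ∞
        (fun x : M × ℝ => (φ (x.1, t₁), x.2 - t₁)) (p, t₂) := by
      refine ContMDiffAt.prodMk ?_ ?_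
      · exact ContMDiffAt.comp (g := φ) (p, t₂) (show ContMDiffAt ((𝓡 m).prod 𝓘(ℝ, ℝ)) (𝓡 m) ∞ φ
          (p, t₁) from hA₁) (contMDiffAt_fst.prodMk contMDiffAt_const)
      · exact contMDiffAt_snd.sub contMDiffAt_const
    have h3 : φ = φ ∘ fun x : M × ℝ => (φ (x.1, t₁), x.2 - t₁) := by
      ext1 x
      rw [Function.comp_apply, hφ.add hM, add_sub_cancel]
    change ContMDiffAt ((𝓡 m).prod 𝓘(ℝ, ℝ)) (𝓡 m) ∞ φ (p, t₂)
    rw [h3]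
    exact ContMDiffAt.comp (g := φ) (p, t₂) h1 h2
  have hclopen : IsClopen A := by
    constructor
    · refine isOpen_compl_iff.mp (Metric.isOpen_iff.mpr fun t₀ ht₀ => ?_)
      obtain ⟨η, hη, h⟩ := hstep t₀
      exact ⟨η, hη, fun t₁ ht₁ hA₁ => ht₀ (h t₁ ht₁ t₀ (Metric.mem_ball_self hη) hA₁)⟩
    · refine Metric.isOpen_iff.mpr fun t₀ ht₀ => ?_
      obtain ⟨η, hη, h⟩ := hstep t₀
      exact ⟨η, hη, fun t₁ ht₁ => h t₀ (Metric.mem_ball_self hη) t₁ ht₁ ht₀⟩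
  have h0 : (0 : ℝ) ∈ A := by
    obtain ⟨ρ, hρ, U, -, hU, hsm⟩ := hφ.exists_contMDiffAt hM he he1 p
    exact hsm p hU 0 (by simpa using hρ)
  exact (Set.ext_iff.mp (hclopen.eq_univ ⟨0, h0⟩) t).mpr trivial

end IsTranslationFlow

end IsLambdaHypersurface

/-! ### Splitting off the last coordinate -/

section LastCoordinate

/-- The inclusion of `R^k` in `R^{k+1}` as a coordinate hyperplane. -/
noncomputable def inclLast (k : ℕ) : Euc k →ₗᵢ[ℝ] Euc (k + 1) where
  toFun x := WithLp.toLp 2 (Fin.snoc (fun i => x i) 0 : Fin (k + 1) → ℝ)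
  map_add' x y := by
    ext i
    refine Fin.lastCases ?_ (fun i => ?_) i <;> simp
  map_smul' c x := by
    ext i
    refine Fin.lastCases ?_ (fun i => ?_) i <;> simp
  norm_map' x := by
    simp [EuclideanSpace.norm_eq, Fin.sum_univ_castSucc]

/-- The projection of `R^{k+1}` to `R^k` that forgets the last coordinate. -/
noncomputable def dropLast (k : ℕ) : Euc (k + 1) →L[ℝ] Euc k :=
  LinearMap.toContinuousLinearMap
    { toFun := fun x => WithLp.toLp 2 fun i => x i.castSucc
      map_add' := fun x y => by ext i; simp
      map_smul' := fun c x => by ext i; simp }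

/-- The last vector of the standard basis. -/
noncomputable def lastVec (k : ℕ) : Euc (k + 1) := EuclideanSpace.single (Fin.last k) 1

variable {k : ℕ}

@[simp]
theorem dropLast_apply (x : Euc (k + 1)) (i : Fin k) : dropLast k x i = x i.castSucc := rfl

@[simp]
theorem inclLast_castSucc (x : Euc k) (i : Fin k) : inclLast k x i.castSucc = x i := by
  simp [inclLast]

@[simp]
theorem inclLast_last (x : Euc k) : inclLast k x (Fin.last k) = 0 := by
  simp [inclLast]

theorem inclLast_dropLast {x : Euc (k + 1)} (hx : x (Fin.last k) = 0) :
    inclLast k (dropLast k x) = x := by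
  ext i
  refine Fin.lastCases ?_ (fun i => ?_) i <;> simp [hx]

theorem inner_lastVec (x : Euc (k + 1)) : inner ℝ x (lastVec k) = x (Fin.last k) := by
  simp [lastVec, EuclideanSpace.inner_single_right]

theorem lastVec_last : lastVec k (Fin.last k) = 1 := by simp [lastVec]

theorem norm_lastVec : ‖lastVec k‖ = 1 := by simp [lastVec]

theorem inner_inclLast_lastVec (x : Euc k) : inner ℝ (inclLast k x) (lastVec k) = 0 := by
  rw [inner_lastVec, inclLast_last]

end LastCoordinate

/-! ### Charts of the slice -/

section SliceCharts

variable {n : ℕ} {M : Type*} [TopologicalSpace M]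

/-- The intersection of the hypersurface with the hyperplane on which the last coordinate
vanishes. -/
abbrev Slice (X : M → Euc (n + 2)) : Type _ := {q : M // X q (Fin.last (n + 1)) = 0}

variable {X N : M → Euc (n + 2)} {lam : ℝ}

/-- The projection to `R^n × R` whose second component is the last coordinate. -/
noncomputable def sliceProj (π : Euc (n + 2) →L[ℝ] Euc n) : Euc (n + 2) →L[ℝ] Euc n × ℝ :=
  π.prod (EuclideanSpace.proj (Fin.last (n + 1)))

variable [ChartedSpace (Euc (n + 1)) M]

/-- The chart of the slice obtained from a projection chart of the hypersurface. -/
structure IsSliceChart (X : M → Euc (n + 2)) (π : Euc (n + 2) →L[ℝ] Euc n)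
    (f : OpenPartialHomeomorph M (Euc n × ℝ)) (χ : OpenPartialHomeomorph (Slice X) (Euc n)) :
    Prop where
  isProjectionChart : IsProjectionChart X (sliceProj π) f
  apply_eq : ∀ q ∈ χ.source, χ q = π (X q)
  mem_target : ∀ y ∈ χ.target, (y, (0 : ℝ)) ∈ f.target
  symm_apply : ∀ y ∈ χ.target, (χ.symm y : M) = f.symm (y, 0)

theorem IsProjectionChart.exists_isSliceChart {π : Euc (n + 2) →L[ℝ] Euc n}
    {f : OpenPartialHomeomorph M (Euc n × ℝ)} (hf : IsProjectionChart X (sliceProj π) f)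
    (q₀ : Slice X) (hq₀ : (q₀ : M) ∈ f.source) :
    ∃ χ : OpenPartialHomeomorph (Slice X) (Euc n), q₀ ∈ χ.source ∧ IsSliceChart X π f χ := by
  classical
  have hf2 : ∀ q : Slice X, (q : M) ∈ f.source → f q = (π (X q), 0) := fun q hq => by
    rw [hf.proj q hq]
    exact Prod.ext rfl q.2
  have hX : ∀ y, (y, (0 : ℝ)) ∈ f.target → X (f.symm (y, 0)) (Fin.last (n + 1)) = 0 := fun y hy =>
    congrArg Prod.snd (hf.proj_symm hy)
  let g : Euc n → Slice X := fun y =>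
    if hy : (y, (0 : ℝ)) ∈ f.target then ⟨f.symm (y, 0), hX y hy⟩ else q₀
  have hg : ∀ y, (y, (0 : ℝ)) ∈ f.target → (g y : M) = f.symm (y, 0) := fun y hy => by
    simp [g, hy]
  have hopen : IsOpen {y : Euc n | (y, (0 : ℝ)) ∈ f.target} :=
    f.open_target.preimage (by fun_prop)
  let χ : OpenPartialHomeomorph (Slice X) (Euc n) :=
    { toFun := fun q => (f q).1
      invFun := g
      source := {q | (q : M) ∈ f.source}
      target := {y | (y, (0 : ℝ)) ∈ f.target}
      map_source' := fun q hq => by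
        have h1 := f.map_source hq
        rw [hf2 q hq] at h1
        change ((f q).1, (0 : ℝ)) ∈ f.target
        rwa [hf2 q hq]
      map_target' := fun y hy => by
        change (g y : M) ∈ f.source
        rw [hg y hy]
        exact f.map_target hy
      left_inv' := fun q hq => by
        have h1 := f.map_source hq
        have h2 := f.left_inv hq
        rw [hf2 q hq] at h1 h2
        ext1
        rw [hf2 q hq, hg _ h1, h2]
      right_inv' := fun y hy => by
        rw [hg y hy, f.right_inv hy]
      open_source := f.open_source.preimage continuous_subtype_val
      open_target := hopen
      continuousOn_toFun := fun q hq => by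
        have h1 : ContinuousAt (fun q : Slice X => (f q).1) q :=
          continuousAt_fst.comp ((f.continuousAt hq).comp continuous_subtype_val.continuousAt)
        exact h1.continuousWithinAt
      continuousOn_invFun := by
        refine Topology.IsInducing.subtypeVal.continuousOn_iff.mpr ?_
        have h1 : ContinuousOn (fun y : Euc n => f.symm (y, 0)) {y | (y, (0 : ℝ)) ∈ f.target} :=
          f.continuousOn_symm.comp (by fun_prop) fun y hy => hy
        exact h1.congr fun y hy => hg y hy }
  exact ⟨χ, hq₀, hf, fun q hq => congrArg Prod.fst (hf2 q hq), fun y hy => hy,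
    fun y hy => hg y hy⟩

/-- If the last coordinate vector is tangent to the hypersurface everywhere, its slice has slice
charts around each point. -/
theorem IsLambdaHypersurface.exists_isSliceChart [IsManifold (𝓡 (n + 1)) ∞ M]
    (hM : IsLambdaHypersurface X N lam) (hN : ∀ r, inner ℝ (lastVec (n + 1)) (N r) = 0)
    (q₀ : Slice X) : ∃ π f, ∃ χ : OpenPartialHomeomorph (Slice X) (Euc n), q₀ ∈ χ.source ∧
      IsSliceChart X π f χ := by
  obtain ⟨J, hJN, hJ⟩ := exists_linearIsometry_orthogonal (hM.normal_unit (q₀ : M))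
  obtain ⟨u₀, hu₀⟩ := hJ _ (hN q₀)
  have hu₀1 : ‖u₀‖ = 1 := by rw [← J.norm_map, hu₀, norm_lastVec]
  -- In tangent coordinates `u₀` is the direction of `e`, and the last coordinate is the component
  -- along it. The range of `J'` is its orthogonal complement, so `π` and the last coordinate
  -- together identify the tangent space with `R^n × R`.
  obtain ⟨J', hJ'u, hJ'⟩ := exists_linearIsometry_orthogonal hu₀1
  set π : Euc (n + 2) →L[ℝ] Euc n :=
    J'.toContinuousLinearMap.adjoint.comp J.toContinuousLinearMap.adjoint with hπ
  have hπJ : ∀ a, π (J a) = J'.toContinuousLinearMap.adjoint a := fun a => by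
    simp only [hπ, ContinuousLinearMap.comp_apply, adjoint_apply_apply]
  have hlast : ∀ a, J a (Fin.last (n + 1)) = inner ℝ a u₀ := fun a => by
    rw [← inner_lastVec, ← hu₀, J.inner_map_map]
  have hadj : J'.toContinuousLinearMap.adjoint u₀ = 0 := by
    refine ext_inner_right ℝ fun v => ?_
    rw [ContinuousLinearMap.adjoint_inner_left, inner_zero_left, real_inner_comm]
    exact hJ'u v
  have hbij : Function.Bijective fun v => sliceProj π (differential X (q₀ : M) v) := by
    constructor
    · intro v w hvw
      obtain ⟨a, ha⟩ := hJ _ (hM.normal_orthogonal q₀ v)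
      obtain ⟨b, hb⟩ := hJ _ (hM.normal_orthogonal q₀ w)
      have h1 : sliceProj π (J a) = sliceProj π (J b) := by rw [ha, hb]; exact hvw
      have h2 : J'.toContinuousLinearMap.adjoint (a - b) = 0 := by
        rw [map_sub, ← hπJ, ← hπJ, sub_eq_zero]
        exact congrArg Prod.fst h1
      have h3 : (inner ℝ (a - b) u₀ : ℝ) = 0 := by
        rw [inner_sub_left, ← hlast, ← hlast, sub_eq_zero]
        exact congrArg Prod.snd h1
      obtain ⟨d, hd⟩ := hJ' _ h3
      rw [← hd, adjoint_apply_apply] at h2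
      rw [h2, map_zero] at hd
      refine hM.immersion q₀ ?_
      rw [← ha, ← hb, sub_eq_zero.mp hd.symm]
    · rintro ⟨b, s⟩
      obtain ⟨v, hv⟩ := hM.exists_differential_eq (q₀ : M) (hJN (J' b + s • u₀))
      refine ⟨v, ?_⟩
      simp only [hv]
      refine Prod.ext ?_ ?_
      · change π (J (J' b + s • u₀)) = b
        rw [hπJ, map_add, map_smul, hadj, adjoint_apply_apply, smul_zero, add_zero]
      · change J (J' b + s • u₀) (Fin.last (n + 1)) = s
        rw [hlast, inner_add_left, hJ'u, inner_smul_left, real_inner_self_eq_norm_sq, hu₀1]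
        simp
  obtain ⟨f, hq₀, hf⟩ := hM.exists_isProjectionChart (sliceProj π) (q₀ : M) hbij
  obtain ⟨χ, h1, h2⟩ := hf.exists_isSliceChart q₀ hq₀
  exact ⟨π, f, χ, h1, h2⟩

end SliceCharts

/-! ### Maps induced on the slice -/

section SliceMap

variable {n : ℕ} {M : Type*} {X N : M → Euc (n + 2)}

/-- The map to `R^{n+1}` given on the slice by the first coordinates of `G`. -/
noncomputable def sliceMap (X G : M → Euc (n + 2)) (q : Slice X) : Euc (n + 1) :=
  dropLast (n + 1) (G q)

theorem inclLast_sliceMap (q : Slice X) : inclLast (n + 1) (sliceMap X X q) = X q :=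
  inclLast_dropLast q.2

theorem inclLast_sliceMap_normal (hN : ∀ p, N p (Fin.last (n + 1)) = 0) (q : Slice X) :
    inclLast (n + 1) (sliceMap X N q) = N q :=
  inclLast_dropLast (hN q)

theorem deriv_deriv_clm_comp {E F : Type*} [NormedAddCommGroup E] [NormedSpace ℝ E]
    [NormedAddCommGroup F] [NormedSpace ℝ F] (L : E →L[ℝ] F) {y : ℝ → E} {t : ℝ}
    (hy : ContDiffAt ℝ 2 y t) : deriv (fun s => L (y s)) t = L (deriv y t) ∧
      deriv (deriv fun s => L (y s)) t = L (deriv (deriv y) t) := by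
  have h := deriv_deriv_comp (x := L) L.contDiff.contDiffAt hy
  have h1 : fderiv ℝ L = fun _ => L := funext fun z => L.fderiv
  rw [h1] at h
  simpa [Function.comp_def] using h

end SliceMap

/-! ### The slice as a hypersurface one dimension lower -/

section SliceManifold

variable {n : ℕ} {M : Type*} [TopologicalSpace M] [ChartedSpace (Euc (n + 1)) M]
  {X N : M → Euc (n + 2)} {lam : ℝ} [ChartedSpace (Euc n) (Slice X)]

/-- All charts of the slice are slice charts. -/
def HasSliceAtlas (X : M → Euc (n + 2)) [ChartedSpace (Euc n) (Slice X)] : Prop :=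
  ∀ χ ∈ atlas (Euc n) (Slice X), ∃ π f, IsSliceChart X π f χ

namespace HasSliceAtlas

variable (hS : HasSliceAtlas X)
include hS

/-- A transition map is `y ↦ π' (X (f.symm (y, 0)))`, since each chart of the slice is the
restriction of a map `π' ∘ X` smooth on all of `M`. -/
theorem isManifold (hX : ContMDiff (𝓡 (n + 1)) (𝓡 (n + 2)) ∞ X) :
    IsManifold (𝓡 n) ∞ (Slice X) := by
  refine isManifold_of_contDiffOn _ _ _ fun e e' he he' => ?_
  obtain ⟨π, f, h⟩ := hS e he
  obtain ⟨π', f', h'⟩ := hS e' he'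
  simp only [modelWithCornersSelf_coe, modelWithCornersSelf_coe_symm, Set.range_id,
    Set.inter_univ, Set.preimage_id, Function.id_comp, Function.comp_id]
  have h1 : ContDiffOn ℝ ∞ (fun y : Euc n => π' ((X ∘ f.symm) (y, 0))) e.target :=
    π'.contDiff.comp_contDiffOn ((h.isProjectionChart.contDiffOn_comp_symm hX).comp
      (contDiff_id.prodMk contDiff_const).contDiffOn h.mem_target)
  refine (h1.mono fun y hy => hy.1).congr fun y hy => ?_
  have h2 : e' (e.symm y) = π' (X (e.symm y : Slice X)) := h'.apply_eq _ hy.2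
  rw [h.symm_apply y hy.1] at h2
  exact h2

/-- Charts of the slice are restrictions of `π ∘ X`, so smoothness into `M` already gives smoothness
into the slice. -/
theorem contMDiff_of_val {E' H' B : Type*} [NormedAddCommGroup E'] [NormedSpace ℝ E']
    [TopologicalSpace H'] {I : ModelWithCorners ℝ E' H'} [TopologicalSpace B] [ChartedSpace H' B]
    (hX : ContMDiff (𝓡 (n + 1)) (𝓡 (n + 2)) ∞ X)
    {g : B → Slice X} (hg : ContMDiff I (𝓡 (n + 1)) ∞ fun b => (g b : M)) :
    ContMDiff I (𝓡 n) ∞ g := by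
  intro b
  have hgc : Continuous g :=
    Topology.IsInducing.subtypeVal.continuous_iff.mpr hg.continuous
  refine contMDiffAt_iff_target.mpr ⟨hgc.continuousAt, ?_⟩
  obtain ⟨π, f, h⟩ := hS _ (chart_mem_atlas (Euc n) (g b))
  have h1 : ContMDiff I 𝓘(ℝ, Euc n) ∞ fun b => π (X (g b)) :=
    π.contMDiff.comp (hX.comp hg)
  refine h1.contMDiffAt.congr_of_eventuallyEq ?_
  filter_upwards [hgc.continuousAt ((chartAt (Euc n) (g b)).open_source.mem_nhds
    (mem_chart_source _ _))] with b' hb'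
  exact h.apply_eq _ hb'

variable [IsManifold (𝓡 n) ∞ (Slice X)]

theorem contMDiff_val : ContMDiff (𝓡 n) (𝓡 (n + 1)) ∞ (Subtype.val : Slice X → M) := by
  intro q
  obtain ⟨π, f, h⟩ := hS _ (chart_mem_atlas (Euc n) q)
  set χ := chartAt (Euc n) q with hχ
  have hq : q ∈ χ.source := mem_chart_source _ _
  have h1 : ContMDiffAt (𝓡 n) (𝓡 n) ∞ χ q :=
    contMDiffAt_of_mem_maximalAtlas (IsManifold.chart_mem_maximalAtlas q) hq
  have h2 : ContMDiff (𝓡 n) 𝓘(ℝ, Euc n × ℝ) ∞ fun y : Euc n => (y, (0 : ℝ)) :=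
    (contDiff_id.prodMk contDiff_const).contMDiff
  have h3 := h.isProjectionChart.smoothAt_symm (h.mem_target _ (χ.map_source hq))
  have h4 : ContMDiffAt (𝓡 n) (𝓡 (n + 1)) ∞ (fun r => f.symm (χ r, 0)) q :=
    (h3.comp (χ q) h2.contMDiffAt).comp q h1
  refine h4.congr_of_eventuallyEq ?_
  filter_upwards [χ.open_source.mem_nhds hq] with r hr
  rw [← h.symm_apply _ (χ.map_source hr), χ.left_inv hr]

theorem contMDiff_sliceMap {G : M → Euc (n + 2)}
    (hG : ContMDiff (𝓡 (n + 1)) (𝓡 (n + 2)) ∞ G) :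
    ContMDiff (𝓡 n) (𝓡 (n + 1)) ∞ (sliceMap X G) :=
  (dropLast (n + 1)).contMDiff.comp (hG.comp hS.contMDiff_val)

end HasSliceAtlas

variable (hM : IsLambdaHypersurface X N lam) (hS : HasSliceAtlas X)
  (hN : ∀ p, N p (Fin.last (n + 1)) = 0) [IsManifold (𝓡 n) ∞ (Slice X)]
include hM hS

theorem HasSliceAtlas.inclLast_differential (q : Slice X) (v : TangentSpace (𝓡 n) q) :
    inclLast (n + 1) (differential (sliceMap X X) q v) =
      differential X (q : M) (mfderiv (𝓡 n) (𝓡 (n + 1)) (Subtype.val : Slice X → M) q v) := by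
  have h1 : HasMFDerivAt (𝓡 n) (𝓡 (n + 1)) (sliceMap X X) q (differential (sliceMap X X) q) :=
    ((hS.contMDiff_sliceMap hM.smooth).mdifferentiable (by simp) q).hasMFDerivAt
  have h2 := ((inclLast (n + 1)).toContinuousLinearMap.hasMFDerivAt.comp q h1).mfderiv
  have h3 := ((hM.hasMFDerivAt (q : M)).comp q
    ((hS.contMDiff_val).mdifferentiable (by simp) q).hasMFDerivAt).mfderiv
  have h4 : (inclLast (n + 1)).toContinuousLinearMap ∘ sliceMap X X =
      X ∘ (Subtype.val : Slice X → M) := funext fun q => inclLast_sliceMap q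
  rw [h4, h3] at h2
  exact (congrArg (fun L : TangentSpace (𝓡 n) q →L[ℝ] Euc (n + 2) => L v) h2).symm

/-- In a slice chart, `π` composed with the inclusion of `R^{n+1}` is a linear left inverse of the
parametrization, and hence of its derivative. -/
theorem HasSliceAtlas.injective_differential (q : Slice X) :
    Function.Injective (differential (sliceMap X X) q) := by
  obtain ⟨π, f, h⟩ := hS _ (chart_mem_atlas (Euc n) q)
  set χ := chartAt (Euc n) q with hχ
  have hq : χ q ∈ χ.target := χ.map_source (mem_chart_source _ _)
  have hsm := hS.contMDiff_sliceMap hM.smooth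
  rw [differential_eq_fderiv hsm]
  set L : Euc (n + 1) →L[ℝ] Euc n := π.comp (inclLast (n + 1)).toContinuousLinearMap with hL
  have h1 : (fun y => L ((sliceMap X X ∘ χ.symm) y)) =ᶠ[𝓝 (χ q)] fun y => y := by
    filter_upwards [χ.open_target.mem_nhds hq] with y hy
    have h2 : L (sliceMap X X (χ.symm y)) = π (X (χ.symm y)) := by
      change π (inclLast (n + 1) (sliceMap X X (χ.symm y))) = _
      rw [inclLast_sliceMap]
    rw [Function.comp_apply, h2, ← h.apply_eq _ (χ.map_target hy), χ.right_inv hy]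
  have h2 : ContDiffOn ℝ ∞ (sliceMap X X ∘ χ.symm) χ.target := by
    simpa using contDiffOn_comp_extChartAt_symm hsm q
  have h3 := (L.hasFDerivAt.comp (χ q) ((h2.contDiffAt
    (χ.open_target.mem_nhds hq)).differentiableAt (by simp)).hasFDerivAt).fderiv
  have h4 : fderiv ℝ (fun y => L ((sliceMap X X ∘ χ.symm) y)) (χ q) =
      ContinuousLinearMap.id ℝ (Euc n) := by
    rw [h1.fderiv_eq]
    exact fderiv_fun_id
  refine Function.LeftInverse.injective (g := L) fun v => ?_
  have h5 := congrArg (fun A : Euc n →L[ℝ] Euc n => A v) (h3.symm.trans h4)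
  exact h5

include hN

theorem HasSliceAtlas.inner_differential_normal (q : Slice X) (v : TangentSpace (𝓡 n) q) :
    inner ℝ (differential (sliceMap X X) q v) (sliceMap X N q) = 0 := by
  rw [← (inclLast (n + 1)).inner_map_map, inclLast_sliceMap_normal hN,
    hS.inclLast_differential hM]
  exact hM.normal_orthogonal _ _

/-- The slice has the same mean curvature as the hypersurface, if the latter is invariant by the
translations in the last direction. -/
theorem HasSliceAtlas.meanCurvature_sliceMap [IsManifold (𝓡 (n + 1)) ∞ M] {φ : M × ℝ → M}
    (hφ : IsLambdaHypersurface.IsTranslationFlow X (lastVec (n + 1)) φ)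
    (hφs : ContMDiff ((𝓡 (n + 1)).prod 𝓘(ℝ, ℝ)) (𝓡 (n + 1)) ∞ φ) (q : Slice X) :
    meanCurvature (sliceMap X X) (sliceMap X N) q = meanCurvature X N (q : M) := by
  set χ := chartAt (Euc n) q with hχ
  have hq : χ q ∈ χ.target := χ.map_source (mem_chart_source _ _)
  have hsm := hS.contMDiff_sliceMap hM.smooth
  set D : Euc n →L[ℝ] Euc (n + 1) := fderiv ℝ (sliceMap X X ∘ χ.symm) (χ q) with hD
  have hDinj : Function.Injective D := by
    have := hS.injective_differential hM q
    rw [differential_eq_fderiv hsm] at this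
    exact this
  have hds : ContDiffAt ℝ ∞ (sliceMap X X ∘ χ.symm) (χ q) := by
    have h2 : ContDiffOn ℝ ∞ (sliceMap X X ∘ χ.symm) χ.target := by
      simpa using contDiffOn_comp_extChartAt_symm hsm q
    exact h2.contDiffAt (χ.open_target.mem_nhds hq)
  -- An orthonormal basis of the tangent space of the slice; the `b i` are its coordinates in the
  -- chart.
  obtain ⟨J, hJ⟩ := exists_linearIsometry_range (LinearMap.range D.toLinearMap)
    (k := n) (by rw [LinearMap.finrank_range_of_inj hDinj]; simp)
  choose b hb using fun i : Fin n =>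
    (show J (EuclideanSpace.single i 1) ∈ LinearMap.range D.toLinearMap from (hJ _).mpr ⟨_, rfl⟩)
  have hl : ∀ i, ContDiff ℝ ∞ (fun t : ℝ => χ q + t • b i) := fun i =>
    contDiff_const.add (contDiff_id.smul contDiff_const)
  have hld : ∀ i, deriv (fun t : ℝ => χ q + t • b i) 0 = b i := fun i => by
    have : HasDerivAt (fun t : ℝ => χ q + t • b i) (b i) 0 := by
      simpa using ((hasDerivAt_id (0 : ℝ)).smul_const (b i)).const_add (χ q)
    exact this.deriv
  let c : Fin n → ℝ → Slice X := fun i t => χ.symm (χ q + t • b i)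
  have hc0 : ∀ i, c i 0 = q := fun i => by
    simp [c, χ.left_inv (mem_chart_source (Euc n) q)]
  have hcs : ∀ i, ContMDiffAt 𝓘(ℝ, ℝ) (𝓡 n) ∞ (c i) 0 := fun i => by
    have h1 : ContMDiffAt (𝓡 n) (𝓡 n) ∞ χ.symm (χ q + (0 : ℝ) • b i) := by
      rw [zero_smul, add_zero]
      exact contMDiffAt_symm_of_mem_maximalAtlas (IsManifold.chart_mem_maximalAtlas q) hq
    exact h1.comp 0 (hl i).contDiffAt.contMDiffAt
  have hys : ∀ i, ContDiffAt ℝ 2 (sliceMap X X ∘ c i) 0 := fun i =>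
    (contMDiffAt_iff_contDiffAt.mp (hsm.contMDiffAt.comp 0 (hcs i))).of_le two_le_infty
  have hcd : ∀ i, deriv (sliceMap X X ∘ c i) 0 = J (EuclideanSpace.single i 1) := fun i => by
    have h1 := (deriv_deriv_comp (x := sliceMap X X ∘ χ.symm) (y := fun t : ℝ => χ q + t • b i)
      (t := 0) (by simpa using hds.of_le two_le_infty) ((hl i).contDiffAt.of_le two_le_infty)).1
    rw [hld, zero_smul, add_zero] at h1
    rw [← hb i]
    exact h1
  have ho : Orthonormal ℝ fun i => deriv (sliceMap X X ∘ c i) 0 := by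
    simp only [hcd]
    exact EuclideanSpace.orthonormal_single.comp_linearIsometry J
  have hXc : ∀ i, (X ∘ fun t => (c i t : M)) =
      fun t => (inclLast (n + 1)).toContinuousLinearMap ((sliceMap X X ∘ c i) t) := fun i =>
    funext fun t => (inclLast_sliceMap (c i t)).symm
  have hφd : (deriv (X ∘ fun t => φ ((q : M), t))) = fun _ => lastVec (n + 1) := by
    have h1 : (X ∘ fun t => φ ((q : M), t)) = fun t : ℝ => X q + t • lastVec (n + 1) :=
      funext fun t => hφ.translate _ _
    rw [h1]
    ext1 t
    have : HasDerivAt (fun t : ℝ => X q + t • lastVec (n + 1)) (lastVec (n + 1)) t := by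
      simpa using ((hasDerivAt_id t).smul_const (lastVec (n + 1))).const_add (X q)
    exact this.deriv
  have hXd := fun i => deriv_deriv_clm_comp (inclLast (n + 1)).toContinuousLinearMap (hys i)
  have hXd1 : ∀ i, deriv (X ∘ fun t => (c i t : M)) 0 =
      inclLast (n + 1) (deriv (sliceMap X X ∘ c i) 0) := fun i => by
    rw [hXc]
    exact (hXd i).1
  -- The curves of the slice, completed by the flow line through `q`. The latter has unit velocity
  -- orthogonal to the slice and zero acceleration, so it adds nothing to the mean curvature.
  let c' : Fin (n + 1) → ℝ → M :=
    Fin.snoc (α := fun _ => ℝ → M) (fun i t => (c i t : M)) fun t => φ (q, t)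
  have hc'1 : ∀ i : Fin n, c' i.castSucc = fun t => (c i t : M) := fun i => by simp [c']
  have hc'2 : c' (Fin.last n) = fun t => φ (q, t) := by simp [c']
  rw [meanCurvature_eq_sum hsm (hS.inner_differential_normal hM hN q) hc0 hcs ho,
    meanCurvature_eq_sum hM.smooth (hM.normal_orthogonal (q : M)) (c := c') ?_ ?_ ?_,
    Fin.sum_univ_castSucc]
  · simp only [hc'1, hc'2, hXc, hφd, deriv_const', inner_zero_left, add_zero]
    refine Finset.sum_congr rfl fun i _ => ?_
    rw [(hXd i).2, LinearIsometry.coe_toContinuousLinearMap, ← inclLast_sliceMap_normal hN,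
      LinearIsometry.inner_map_map]
  · refine Fin.lastCases ?_ fun i => ?_
    · rw [hc'2]
      exact hφ.zero _
    · rw [hc'1]
      exact congrArg Subtype.val (hc0 i)
  · refine Fin.lastCases ?_ fun i => ?_
    · rw [hc'2]
      exact hφs.contMDiffAt.comp 0 (contMDiffAt_const.prodMk contMDiffAt_id)
    · rw [hc'1]
      exact hS.contMDiff_val.contMDiffAt.comp 0 (hcs i)
  · rw [orthonormal_iff_ite]
    have ho' := orthonormal_iff_ite.mp ho
    refine Fin.lastCases (Fin.lastCases ?_ fun j => ?_) fun i => Fin.lastCases ?_ fun j => ?_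
    · simp [hc'2, hφd, norm_lastVec]
    · simp only [hc'1, hc'2, hXd1, hφd]
      rw [real_inner_comm, inner_inclLast_lastVec, if_neg (Fin.castSucc_lt_last j).ne']
    · simp only [hc'1, hc'2, hXd1, hφd]
      rw [inner_inclLast_lastVec, if_neg (Fin.castSucc_lt_last i).ne]
    · simp only [hc'1, hXd1, LinearIsometry.inner_map_map, Fin.castSucc_inj]
      exact ho' i j

theorem HasSliceAtlas.isLambdaHypersurface [IsManifold (𝓡 (n + 1)) ∞ M] {φ : M × ℝ → M}
    (hφ : IsLambdaHypersurface.IsTranslationFlow X (lastVec (n + 1)) φ)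
    (hφs : ContMDiff ((𝓡 (n + 1)).prod 𝓘(ℝ, ℝ)) (𝓡 (n + 1)) ∞ φ) :
    IsLambdaHypersurface (sliceMap X X) (sliceMap X N) lam where
  smooth := hS.contMDiff_sliceMap hM.smooth
  immersion := hS.injective_differential hM
  normal_smooth := hS.contMDiff_sliceMap hM.normal_smooth
  normal_unit q := by
    rw [← (inclLast (n + 1)).norm_map, inclLast_sliceMap_normal hN]
    exact hM.normal_unit _
  normal_orthogonal := hS.inner_differential_normal hM hN
  curvature q := by
    rw [weightedMeanCurvature, hS.meanCurvature_sliceMap hM hN hφ hφs,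
      ← (inclLast (n + 1)).inner_map_map, inclLast_sliceMap_normal hN, inclLast_sliceMap]
    exact hM.curvature _

end SliceManifold

/-! ### The isometric splitting -/

section Splitting

variable {n : ℕ} {M : Type*} [TopologicalSpace M] {X : M → Euc (n + 2)} {φ : M × ℝ → M}

namespace IsLambdaHypersurface.IsTranslationFlow

variable (hφ : IsTranslationFlow X (lastVec (n + 1)) φ)
include hφ

theorem last (p : M) (t : ℝ) :
    X (φ (p, t)) (Fin.last (n + 1)) = X p (Fin.last (n + 1)) + t := by
  rw [hφ.translate]
  simp [lastVec_last]

/-- The projection to the slice along the flow lines. -/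
def toSlice (p : M) : Slice X :=
  ⟨φ (p, -X p (Fin.last (n + 1))), by rw [hφ.last, add_neg_cancel]⟩

theorem toSlice_val (q : Slice X) : hφ.toSlice q = q := by
  ext1
  change φ ((q : M), -X q (Fin.last (n + 1))) = q
  rw [q.2, neg_zero, hφ.zero]

/-- The slice is a continuous retract of `M`: each point is moved along its flow line to height
zero. -/
theorem connectedSpace_slice [ConnectedSpace M] (hX : Continuous X) (hφc : Continuous φ) :
    ConnectedSpace (Slice X) := by
  have h1 : Continuous hφ.toSlice := by
    refine Continuous.subtype_mk ?_ _
    fun_prop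
  exact Function.Surjective.connectedSpace (f := hφ.toSlice)
    (fun q => ⟨q, hφ.toSlice_val q⟩) h1

end IsLambdaHypersurface.IsTranslationFlow

variable [ChartedSpace (Euc (n + 1)) M] [IsManifold (𝓡 (n + 1)) ∞ M] [T2Space M]
  {N : M → Euc (n + 2)} {lam : ℝ}

/-- The diffeomorphism from the product of the slice and the line given by the flow. -/
def HasSliceAtlas.diffeomorph [ChartedSpace (Euc n) (Slice X)] (hS : HasSliceAtlas X)
    [IsManifold (𝓡 n) ∞ (Slice X)] (hM : IsLambdaHypersurface X N lam)
    (hφ : IsLambdaHypersurface.IsTranslationFlow X (lastVec (n + 1)) φ)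
    (hφs : ContMDiff ((𝓡 (n + 1)).prod 𝓘(ℝ, ℝ)) (𝓡 (n + 1)) ∞ φ) :
    Diffeomorph ((𝓡 n).prod 𝓘(ℝ, ℝ)) (𝓡 (n + 1)) (Slice X × ℝ) M ∞ where
  toFun x := φ (x.1, x.2)
  invFun p := (hφ.toSlice p, X p (Fin.last (n + 1)))
  left_inv := by
    rintro ⟨q, t⟩
    have h1 : X (φ ((q : M), t)) (Fin.last (n + 1)) = t := by rw [hφ.last, q.2, zero_add]
    refine Prod.ext (Subtype.ext ?_) h1
    change φ (φ ((q : M), t), -X (φ ((q : M), t)) (Fin.last (n + 1))) = q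
    rw [h1, hφ.add hM, add_neg_cancel, hφ.zero]
  right_inv p := by
    change φ (φ (p, -X p (Fin.last (n + 1))), X p (Fin.last (n + 1))) = p
    rw [hφ.add hM, neg_add_cancel, hφ.zero]
  contMDiff_toFun :=
    hφs.comp ((hS.contMDiff_val.comp contMDiff_fst).prodMk contMDiff_snd)
  contMDiff_invFun := by
    have h1 : ContMDiff (𝓡 (n + 1)) 𝓘(ℝ, ℝ) ∞ fun p => X p (Fin.last (n + 1)) :=
      (EuclideanSpace.proj (𝕜 := ℝ) (Fin.last (n + 1))).contMDiff.comp hM.smooth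
    have h2 : ContMDiff (𝓡 (n + 1)) 𝓘(ℝ, ℝ) ∞ fun p => -X p (Fin.last (n + 1)) :=
      contDiff_neg.contMDiff.comp h1
    exact (hS.contMDiff_of_val hM.smooth (hφs.comp (contMDiff_id.prodMk h2))).prodMk h1

theorem IsLambdaHypersurface.splitsAsCylinder [SecondCountableTopology M] [ConnectedSpace M]
    (hM : IsLambdaHypersurface X N lam) (hproper : IsProperMap X)
    (hN : ∀ p, N p (Fin.last (n + 1)) = 0) : SplitsAsCylinder X lam := by
  have he : ∀ r, inner ℝ (lastVec (n + 1)) (N r) = 0 := fun r => by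
    rw [real_inner_comm, inner_lastVec, hN]
  obtain ⟨φ, hφ⟩ := hM.exists_isTranslationFlow hproper he
  have hφs := hφ.contMDiff hM he norm_lastVec
  choose π f χ hχ hχs using hM.exists_isSliceChart he
  let _ : ChartedSpace (Euc n) (Slice X) :=
    { atlas := Set.range χ
      chartAt := χ
      mem_chart_source := hχ
      chart_mem_atlas := fun q => ⟨q, rfl⟩ }
  have hS : HasSliceAtlas X := by
    rintro _ ⟨q, rfl⟩
    exact ⟨π q, f q, hχs q⟩
  have := hS.isManifold hM.smooth
  have := hφ.connectedSpace_slice hM.smooth.continuous hφs.continuous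
  have hsm := hS.contMDiff_sliceMap hM.smooth
  refine ⟨Slice X, inferInstance, inferInstance, inferInstance, inferInstance,
    TopologicalSpace.Subtype.secondCountableTopology _, inferInstance, sliceMap X X, sliceMap X N, hS.diffeomorph hM hφ hφs,
    hS.isLambdaHypersurface hM hN hφ hφs, ?_, ?_⟩
  · have hd : ∀ (q : Slice X) (t : ℝ) (v : TangentSpace (𝓡 n) q) (a : ℝ),
        differential X (hS.diffeomorph hM hφ hφs (q, t))
          (mfderiv ((𝓡 n).prod 𝓘(ℝ, ℝ)) (𝓡 (n + 1)) (hS.diffeomorph hM hφ hφs) (q, t) (v, a)) =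
        inclLast (n + 1) (differential (sliceMap X X) q v) + a • lastVec (n + 1) := by
      intro q t v a
      have h1 := (hM.hasMFDerivAt (hS.diffeomorph hM hφ hφs (q, t))).comp (q, t)
        ((hS.diffeomorph hM hφ hφs).contMDiff.mdifferentiable (by simp) (q, t)).hasMFDerivAt
      have h2 : HasMFDerivAt (𝓡 n) (𝓡 (n + 1)) (sliceMap X X) q
          (differential (sliceMap X X) q) := (hsm.mdifferentiable (by simp) q).hasMFDerivAt
      have h3 := ((inclLast (n + 1)).toContinuousLinearMap.hasMFDerivAt.comp (q, t)
        (h2.comp (q, t) (hasMFDerivAt_fst (I := 𝓡 n) (I' := 𝓘(ℝ, ℝ)) (q, t)))).add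
        ((ContinuousLinearMap.toSpanSingleton ℝ (lastVec (n + 1))).hasMFDerivAt.comp (q, t)
          (hasMFDerivAt_snd (I := 𝓡 n) (I' := 𝓘(ℝ, ℝ)) (q, t)))
      -- In the ambient space the map is `(q, t) ↦ (X' q, 0) + t • e`; its differential has two
      -- orthogonal parts, whence the product metric.
      have h4 : X ∘ hS.diffeomorph hM hφ hφs =
          (inclLast (n + 1)).toContinuousLinearMap ∘ sliceMap X X ∘ Prod.fst +
            ContinuousLinearMap.toSpanSingleton ℝ (lastVec (n + 1)) ∘ Prod.snd := by
        ext1 ⟨q, t⟩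
        change X (φ ((q : M), t)) = inclLast (n + 1) (sliceMap X X q) + t • lastVec (n + 1)
        rw [hφ.translate, inclLast_sliceMap]
      rw [h4] at h1
      exact congrArg (fun L : TangentSpace (𝓡 n) q × ℝ →L[ℝ] Euc (n + 2) => L (v, a))
        (hasMFDerivAt_unique h1 h3)
    intro q t v w a b
    rw [inducedMetric, hd, hd, inner_add_left, inner_add_right, inner_add_right,
      LinearIsometry.inner_map_map, inner_smul_right, inner_smul_left, inner_smul_left,
      inner_smul_right, inner_inclLast_lastVec, 
      real_inner_comm (inclLast (n + 1) _) (lastVec (n + 1)), inner_inclLast_lastVec,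
      real_inner_self_eq_norm_sq, norm_lastVec, inducedMetric]
    simp
  · intro q t
    refine ⟨fun i => ?_, ?_⟩
    · change X (φ ((q : M), t)) i.castSucc = _
      rw [hφ.translate, ← inclLast_sliceMap (X := X) q]
      simp [lastVec, Fin.castSucc_ne_last]
    · change X (φ ((q : M), t)) (Fin.last (n + 1)) = t
      rw [hφ.last, q.2, zero_add]

end Splitting

end GaussianHypersurface

theorem theorem1p1 (n : ℕ) (M : Type*) [TopologicalSpace M]
    [ChartedSpace (GaussianHypersurface.Euc (n + 1)) M] [IsManifold (𝓡 (n + 1)) ∞ M]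
    [T2Space M] [SecondCountableTopology M] [ConnectedSpace M]
    (X N : M → GaussianHypersurface.Euc (n + 2)) (lam : ℝ)
    (hM : GaussianHypersurface.IsLambdaHypersurface X N lam)
    (hcomplete : GaussianHypersurface.IsCompleteImmersion X)
    (hproper : IsProperMap X)
    (hGauss : ∀ p, 0 ≤ N p (Fin.last (n + 1))) :
    GaussianHypersurface.IsHyperplane X ∨ GaussianHypersurface.SplitsAsCylinder X lam := by
  simp only [← GaussianHypersurface.inner_lastVec] at hGauss
  -- A zero of `⟨N, e⟩ ≥ 0` is a minimum with value `c = 0`, so the strong maximum principle makes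
  -- `⟨N, e⟩` vanish identically.
  by_cases h : ∃ p, inner ℝ (N p) (GaussianHypersurface.lastVec (n + 1)) = 0
  · obtain ⟨p, hp⟩ := h
    refine Or.inr (hM.splitsAsCylinder hproper fun q => ?_)
    rw [← GaussianHypersurface.inner_lastVec]
    exact hM.eq_of_min le_rfl hGauss hp q
  · push Not at h
    exact Or.inl (hM.isHyperplane_of_normal_eq hproper
      (hM.normal_eq_of_pos hproper fun q => (hGauss q).lt_of_ne (h q).symm))
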